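/- **Graphs and examples.** Let $R$ be a finite nonempty set of edge labels. A graph $G=(V,E,L)$ is a finite directed graph with vertex labels $L(v)$ and edges $\langle v,r,w\rangle$, $r\in R$; let $N^-_r(v)$ (resp. $N^+_r(v)$) be the set of vertices with an $r$-edge to (resp. from) $v$. An example is a quadruple $s=(Q,u,G,v)$ of a pattern graph $Q$, a data graph $G$ and vertices $u\in Q$, $v\in G$. It is positive if there is a homomorphism $\varphi:Q\to G$ (preserving vertex labels and labelled edges) with $\varphi(u)=v$, and negative otherwise. **The network.** Fix the number $m$ of layers and the embedding dimension $d=2c$. The weights are matrices $W_1$ and $W^{k,r}_b$ in $\mathbb R^{c\times d}$, for $1\le k\le m$, $r\in R$, $b\in\{0,1\}$. First, a filtering stage without trainable parameters (such as any number of rounds of dual simulation) replaces $G$ by a subgraph $G'$. For a vertex $x$ of $H\in\{Q,G'\}$, let $H_x$ be the subgraph of $H$ induced by the vertices within $m$ (undirected) hops of $x$. For $y\in H_x$ put $h^0_y=e(L(y))\in\mathbb R^d$, where $e$ is a fixed feature map, and, for $1\le k\le m$, $$h^k_y=\Bigl(W_1h^{k-1}_y+\sum_{r\in R}\ \sum_{(b,h)\in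 S^-_{k,r}(y)}W^{k,r}_b h\ ,\quad W_1h^{k-1}_y+\sum_{r\in R}\ \sum_{(b,h)\in S^+_{k,r}(y)}W^{k,r}_b h\Bigr),$$ where $S^\pm_{k,r}(y)=\{(b_k(w),h^{k-1}_w): w\in N^\pm_r(y)\}$ is a set, i.e. duplicates are removed, with neighbours taken in $H_x$. In the pattern ($x=u$), $b_k(w)=1$ if $w=u$ and $0$ otherwise; in the data graph ($x=v$), $b_k(w)=1$ if $w=v$ and $Q$ has a directed simple cycle of length $k$ through $u$, and $0$ otherwise. The embedding of $x$ is $h_x=|h^m_x|/\|h^m_x\|_2$ (entrywise absolute value; $0$ if $h^m_x=0$). Let $\mathcal M(a,b)=\|\max(0,a-b)\|_2^2$. For a margin $\alpha\in\mathbb R$, the loss on $(Q,u,G,v)$ is $\mathcal M(h_u,h_v)-\alpha$ for a positive example and $\max\{0,\alpha-\mathcal M(h_u,h_v)\}$ for a negative one. **Loss class.** Let $\mathcal T$ be the class of all functions mapping an example to its loss, where the weights range over all choices with spectral norms $\|W_1\|\le B_1$ and $\|W^{k,r}_b\|\le B_2$. The empirical Rademacher complexity on examples $s_1,\dots,s_{N_T}$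 is $$\hat{\mathcal R}(\mathcal T)=\mathbb E_\sigma\sup_{f\in\mathcal T}\frac1{N_T}\sum_{i=1}^{N_T}\sigma_i f(s_i),$$ with $\sigma$ uniform on $\{-1,1\}^{N_T}$. **Theorem.** For all $R$, $m$, $d=2c$, $\delta$ and $B_1,B_2,B_x\ge 0$ there are constants $M,\mathcal R>0$, determined by these data only, such that the following holds for every set of vertex labels, every feature map $e$ with $\|e(\cdot)\|_2\le B_x$, every filtering stage, every margin $\alpha$, every $N_T\ge1$, and all training examples $s_1,\dots,s_{N_T}$ in whose pattern and data graphs every vertex has at most $\delta$ neighbours: the losses in $\mathcal T$ are bounded on each $s_i$, and $$\hat{\mathcal R}(\mathcal T)\le\frac{8}{N_T}+\frac{12}{\sqrt{N_T}}\sqrt{2|R|d^2\log T},\qquad T=16M\sqrt{N_Td}\,\max\{B_xB_1,\ \mathcal R B_2\}.$$ -/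

import Mathlib

open scoped Matrix Matrix.Norms.L2Operator

noncomputable section

namespace HFrame

/-! ### Directed labelled graphs -/

/-- A finite directed graph with vertex labels in `Λ` and edge labels in `R`;
`(v, r, w) ∈ edges` is an edge from `v` to `w` carrying the label `r`. -/
structure LGraph (Λ R : Type*) where
  n : ℕ
  edges : Finset (Fin n × R × Fin n)
  label : Fin n → Λ

variable {Λ R : Type*}

open Classical in
/-- `N⁻_r(v)`: the vertices with an edge labelled `r` to `v`. -/
def LGraph.inNbrs (G : LGraph Λ R) (r : R) (v : Fin G.n) : Finset (Fin G.n) :=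
  Finset.univ.filter fun w => (w, r, v) ∈ G.edges

open Classical in
/-- `N⁺_r(v)`: the vertices with an edge labelled `r` from `v`. -/
def LGraph.outNbrs (G : LGraph Λ R) (r : R) (v : Fin G.n) : Finset (Fin G.n) :=
  Finset.univ.filter fun w => (v, r, w) ∈ G.edges

open Classical in
/-- `N(v)`: all neighbours of `v`. -/
def LGraph.nbrs (G : LGraph Λ R) (v : Fin G.n) : Finset (Fin G.n) :=
  Finset.univ.filter fun w => ∃ r, (w, r, v) ∈ G.edges ∨ (v, r, w) ∈ G.edges

/-- Every vertex has at most `δ` neighbours. -/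
def LGraph.DegreeLE (G : LGraph Λ R) (δ : ℕ) : Prop :=
  ∀ v, (G.nbrs v).card ≤ δ

open Classical in
/-- The subgraph of `G` whose edges are those in `K`. The vertex type is kept, so that
removing a vertex is modelled by removing all of its edges. -/
def LGraph.keepEdges (G : LGraph Λ R) (K : Set (Fin G.n × R × Fin G.n)) : LGraph Λ R where
  n := G.n
  edges := G.edges.filter (· ∈ K)
  label := G.label

/-- The subgraph of `G` induced by a set `S` of vertices. -/
def LGraph.induced (G : LGraph Λ R) (S : Set (Fin G.n)) : LGraph Λ R :=
  G.keepEdges {e | e.1 ∈ S ∧ e.2.2 ∈ S}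

/-- The set of vertices within `k` hops (in either direction) of `v`. -/
def LGraph.ball (G : LGraph Λ R) (v : Fin G.n) : ℕ → Set (Fin G.n)
  | 0 => {v}
  | k + 1 => G.ball v k ∪ {w | ∃ x ∈ G.ball v k, w ∈ G.nbrs x}

/-- The `m`-hop ego network of `v`. -/
def LGraph.ego (G : LGraph Λ R) (v : Fin G.n) (m : ℕ) : LGraph Λ R :=
  G.induced (G.ball v m)

/-- `v` lies on a (directed, simple) cycle of length `k`. -/
def LGraph.OnCycle (G : LGraph Λ R) (v : Fin G.n) (k : ℕ) : Prop :=
  1 ≤ k ∧ ∃ p : ℕ → Fin G.n, p 0 = v ∧ p k = v ∧ Set.InjOn p (Set.Iio k) ∧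
    ∀ i < k, ∃ r, (p i, r, p (i + 1)) ∈ G.edges

/-- Subgraph homomorphisms from `Q` to `G`. -/
def IsHom (Q G : LGraph Λ R) (φ : Fin Q.n → Fin G.n) : Prop :=
  (∀ u, Q.label u = G.label (φ u)) ∧
    ∀ u r u', (u, r, u') ∈ Q.edges → (φ u, r, φ u') ∈ G.edges

/-! ### Samples and the filtering stage -/

/-- An input `(Q, u, G, v)`: a pattern, a data graph, and a vertex of each. -/
structure Sample (Λ R : Type*) where
  Q : LGraph Λ R
  u : Fin Q.n
  G : LGraph Λ R
  v : Fin G.n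

/-- The positive examples: some homomorphism `Q → G` maps `u` to `v`. -/
def Sample.IsPositive (s : Sample Λ R) : Prop :=
  ∃ φ, IsHom s.Q s.G φ ∧ φ s.u = s.v

/-- A filtering stage without trainable parameters: a rule selecting, for each input
`(Q, u, G, v)`, the edges of `G` that are retained. -/
def Pruning (Λ R : Type*) : Type _ :=
  (s : Sample Λ R) → Set (Fin s.G.n × R × Fin s.G.n)

open Classical in
/-- One step of dual simulation for the pattern edge `e = (a, r, b)`: delete from `C a` the
vertices without an `r`-edge into `C b`. -/
def dualSimOut (G : LGraph Λ R) {q : ℕ} (C : Fin q → Set (Fin G.n)) (e : Fin q × R × Fin q) :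
    Fin q → Set (Fin G.n) :=
  Function.update C e.1 {v ∈ C e.1 | ∃ v' ∈ C e.2.2, (v, e.2.1, v') ∈ G.edges}

open Classical in
/-- One step of dual simulation for the pattern edge `e = (b, r, a)`: delete from `C a` the
vertices without an `r`-edge from `C b`. -/
def dualSimIn (G : LGraph Λ R) {q : ℕ} (C : Fin q → Set (Fin G.n)) (e : Fin q × R × Fin q) :
    Fin q → Set (Fin G.n) :=
  Function.update C e.2.2 {v ∈ C e.2.2 | ∃ v' ∈ C e.1, (v', e.2.1, v) ∈ G.edges}

/-- The candidate sets computed by `τ` rounds of dual simulation. -/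
def dualSim (Q G : LGraph Λ R) : ℕ → Fin Q.n → Set (Fin G.n)
  | 0 => fun u => {v | Q.label u = G.label v}
  | τ + 1 => Q.edges.toList.foldl (dualSimIn G)
      (Q.edges.toList.foldl (dualSimOut G) (dualSim Q G τ))

/-- The filtering stage given by `τ` rounds of dual simulation: keep the subgraph induced by
the vertices that are a candidate for some vertex of the pattern. -/
def dualSimPruning (τ : ℕ) : Pruning Λ R := fun s =>
  {e | (∃ a, e.1 ∈ dualSim s.Q s.G τ a) ∧ ∃ b, e.2.2 ∈ dualSim s.Q s.G τ b}

/-! ### The network -/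

/-- Embeddings have dimension `d = 2 * c`: they are the concatenation of an
"incoming" and an "outgoing" half, each of dimension `c`. -/
abbrev Emb (c : ℕ) : Type := Fin c ⊕ Fin c → ℝ

/-- Concatenation of the two halves. -/
def com {c : ℕ} (a b : Fin c → ℝ) : Emb c := Sum.elim a b

/-- The Euclidean norm. -/
def l2norm {c : ℕ} (x : Emb c) : ℝ := Real.sqrt (∑ i, x i ^ 2)

/-- The trainable weights of a network with `m` layers: `W₁` and, for layer `k + 1`,
edge label `r` and indicator value `b`, the message matrix `W^{k+1,r}_b`. -/
structure Weights (R : Type*) (m c : ℕ) where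
  self : Matrix (Fin c) (Fin c ⊕ Fin c) ℝ
  msg : Fin m → R → Bool → Matrix (Fin c) (Fin c ⊕ Fin c) ℝ

/-- The weights whose spectral norms are bounded by `B₁` and `B₂`. -/
def Weights.Bounded {m c : ℕ} (W : Weights R m c) (B₁ B₂ : ℝ) : Prop :=
  ‖W.self‖ ≤ B₁ ∧ ∀ k r b, ‖W.msg k r b‖ ≤ B₂

open Classical in
/-- The sum of the messages from the vertices in `A`. The received embeddings are collected in
a *set*, so that duplicates are removed; each is tagged by whether it is handled by `W_1`
(`true`) or by `W_0` (`false`). -/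
def message {V : Type*} {c : ℕ} (W : Bool → Matrix (Fin c) (Fin c ⊕ Fin c) ℝ)
    (A : Finset V) (tag : V → Bool) (h : V → Emb c) : Fin c → ℝ :=
  ∑ p ∈ A.image (fun w => (tag w, h w)), W p.1 *ᵥ p.2

open Classical in
/-- The layer-`k` embeddings `h^k` of the vertices of `G` relative to the centre `x`. In layer
`k`, messages from the centre use `W_1` if `active k` holds; all others use `W_0`. -/
def embed [Fintype R] {m c : ℕ} (W : Weights R m c) (feat : Λ → Emb c) (G : LGraph Λ R)
    (x : Fin G.n) (active : ℕ → Prop) : (k : ℕ) → k ≤ m → Fin G.n → Emb c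
  | 0, _ => fun y => feat (G.label y)
  | k + 1, hk => fun y =>
      let h := embed W feat G x active k (Nat.le_of_succ_le hk)
      let tag : Fin G.n → Bool := fun w => decide (w = x ∧ active (k + 1))
      com
        (W.self *ᵥ h y + ∑ r, message (W.msg ⟨k, hk⟩ r) (G.inNbrs r y) tag h)
        (W.self *ᵥ h y + ∑ r, message (W.msg ⟨k, hk⟩ r) (G.outNbrs r y) tag h)

/-- The normalization `|x| / ‖x‖₂` (the zero vector is sent to itself). -/
def normalize {c : ℕ} (x : Emb c) : Emb c := fun i => |x i| / l2norm x

/-- The order-embedding discrepancy `‖max(0, a - b)‖₂²`. -/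
def discrepancy {c : ℕ} (a b : Emb c) : ℝ := ∑ i, (max 0 (a i - b i)) ^ 2

/-- The normalized embedding of the vertex `u` of the pattern `Q`. -/
def patternEmb [Fintype R] {m c : ℕ} (W : Weights R m c) (feat : Λ → Emb c)
    (Q : LGraph Λ R) (u : Fin Q.n) : Emb c :=
  normalize (embed W feat (Q.ego u m) u (fun _ => True) m le_rfl u)

/-- The normalized embedding of the vertex `v` of the data graph `G`, relative to `(Q, u)`. -/
def dataEmb [Fintype R] {m c : ℕ} (W : Weights R m c) (feat : Λ → Emb c)
    (Q : LGraph Λ R) (u : Fin Q.n) (G : LGraph Λ R) (v : Fin G.n) : Emb c :=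
  normalize (embed W feat (G.ego v m) v (fun k => Q.OnCycle u k) m le_rfl v)

open Classical in
/-- The max-margin loss of the network with weights `W` on one training example, after the
filtering stage has been applied to the data graph. -/
def loss [Fintype R] {m c : ℕ} (W : Weights R m c) (feat : Λ → Emb c) (prune : Pruning Λ R)
    (α : ℝ) (s : Sample Λ R) : ℝ :=
  let D := discrepancy (patternEmb W feat s.Q s.u)
    (dataEmb W feat s.Q s.u (s.G.keepEdges (prune s)) s.v)
  if s.IsPositive then D - α else max 0 (α - D)

/-- The loss class: all functions mapping an example to its loss under norm-bounded weights. -/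
def lossClass [Fintype R] (m c : ℕ) (B₁ B₂ : ℝ) (feat : Λ → Emb c) (prune : Pruning Λ R)
    (α : ℝ) : Set (Sample Λ R → ℝ) :=
  {f | ∃ W : Weights R m c, W.Bounded B₁ B₂ ∧ f = loss W feat prune α}

/-! ### Rademacher complexity -/

/-- The empirical Rademacher complexity `E_σ sup_{f ∈ F} (1/N) ∑ i, σ i * f (x i)` of a class
`F` on the points `x`, with `σ` uniform on `{-1, 1}^N`. -/
def empiricalRademacher {X : Type*} {N : ℕ} (F : Set (X → ℝ)) (x : Fin N → X) : ℝ :=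
  (2 ^ N : ℝ)⁻¹ * ∑ σ : Fin N → Bool,
    ⨆ f : F, (N : ℝ)⁻¹ * ∑ i, (if σ i then (1 : ℝ) else -1) * f.1 (x i)

end HFrame

end

/-! The network is discontinuous in its weights, because duplicates are removed and embeddings are
normalized, so coverings of the weight space do not control the losses. The argument is
combinatorial instead. For each input, a coordinate of an embedding agrees on finitely many pieces
with combinations of finitely many functions of the weights (`FinRank`), and the pieces are cut out
by predicates with polynomially many traces. This structure (`Tame`) survives sums, products and
case distinctions, hence all layers (`tame_embed`); the degree bound `δ` makes the number of pieces
and the ranks independent of the graphs. By Sauer–Shelah, positivity sets of tame families have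
polynomial growth, and after squaring away the single root in the discrepancy so do the level sets
of the loss (`polyGrowth_netDisc`, `polyGrowth_level`). Labels, features, filtering and thresholds
are part of the point rather than of the parameter, so every constant is uniform in them.

Massart's lemma alone would bound the Rademacher sums by order `√(N V log N)`, with a growth
exponent `V` depending on `m` and `δ`. The claimed bound has a prescribed coefficient of `log N`
under the root, since `M` can absorb only an additive constant. `PolyGrowth.rademacher` removes `V`
by working at two scales: a net of radius `1/(V+1)` in normalized Hamming distance has size
independent of `N`, and the remainders have squared length at most `N/(V+1)`, which cancels the
factor `V` in the logarithm of their number.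

Averaging over `N` levels transfers this to the losses. The inequality `2|R|d² ≥ 8` absorbs the
absolute coefficient and `M` absorbs the constant. If the scale in `T` vanishes, the loss does not
depend on the weights and its Rademacher average is at most the first term. -/

namespace HFrame

/-! ### Families of predicates with polynomial growth -/

section Growth

variable {Z Z' Θ : Type*}

open Classical in
/-- The subsets of a finite sequence of points that are cut out by the predicates `P · θ`. -/
noncomputable def traces (P : Z → Θ → Prop) {n : ℕ} (z : Fin n → Z) : Finset (Finset (Fin n)) :=
  Finset.univ.filter fun A => ∃ θ, ∀ i, i ∈ A ↔ P (z i) θ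

/-- The number of traces of `P` on `n` points is bounded by a polynomial in `n`. -/
def PolyGrowth (P : Z → Θ → Prop) : Prop :=
  ∃ C V : ℕ, ∀ (n : ℕ) (z : Fin n → Z), (traces P z).card ≤ C * (n + 1) ^ V

theorem mem_traces {P : Z → Θ → Prop} {n : ℕ} {z : Fin n → Z} {A : Finset (Fin n)} :
    A ∈ traces P z ↔ ∃ θ, ∀ i, i ∈ A ↔ P (z i) θ := by
  simp [traces]

theorem PolyGrowth.of_iff {P Q : Z → Θ → Prop} (hP : PolyGrowth P)
    (h : ∀ z θ, Q z θ ↔ P z θ) : PolyGrowth Q := by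
  have : Q = P := by
    funext z θ
    exact propext (h z θ)
  exact this ▸ hP

/-- The bound holds for all finite sequences of points, so it passes to any reindexing with the same
constants. Uniformity in graphs and features comes from here. -/
theorem PolyGrowth.comap {P : Z → Θ → Prop} (hP : PolyGrowth P) (φ : Z' → Z) :
    PolyGrowth fun z θ => P (φ z) θ := by
  obtain ⟨C, V, h⟩ := hP
  exact ⟨C, V, fun n z => h n fun i => φ (z i)⟩

theorem PolyGrowth.const (p : Z → Prop) : PolyGrowth fun z (_ : Θ) => p z := by
  classical
  refine ⟨1, 0, fun n z => ?_⟩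
  rw [pow_zero, mul_one, Finset.card_le_one]
  intro A hA B hB
  obtain ⟨_, hA⟩ := mem_traces.1 hA
  obtain ⟨_, hB⟩ := mem_traces.1 hB
  ext i
  rw [hA, hB]

theorem PolyGrowth.not {P : Z → Θ → Prop} (hP : PolyGrowth P) :
    PolyGrowth fun z θ => ¬ P z θ := by
  classical
  obtain ⟨C, V, h⟩ := hP
  refine ⟨C, V, fun n z => le_trans ?_ (h n z)⟩
  refine Finset.card_le_card_of_injOn compl ?_ compl_injective.injOn
  intro A hA
  obtain ⟨θ, hA⟩ := mem_traces.1 hA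
  exact mem_traces.2 ⟨θ, fun i => by simp [hA]⟩

theorem PolyGrowth.and {P Q : Z → Θ → Prop} (hP : PolyGrowth P) (hQ : PolyGrowth Q) :
    PolyGrowth fun z θ => P z θ ∧ Q z θ := by
  classical
  obtain ⟨C, V, h⟩ := hP
  obtain ⟨C', V', h'⟩ := hQ
  refine ⟨C * C', V + V', fun n z => ?_⟩
  have hsub : traces (fun z θ => P z θ ∧ Q z θ) z ⊆
      Finset.image₂ (· ∩ ·) (traces P z) (traces Q z) := by
    intro A hA
    obtain ⟨θ, hA⟩ := mem_traces.1 hA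
    refine Finset.mem_image₂.2 ⟨Finset.univ.filter fun i => P (z i) θ,
      mem_traces.2 ⟨θ, by simp⟩, Finset.univ.filter fun i => Q (z i) θ,
      mem_traces.2 ⟨θ, by simp⟩, ?_⟩
    ext i
    simp [hA]
  calc (traces (fun z θ => P z θ ∧ Q z θ) z).card
      ≤ (traces P z).card * (traces Q z).card :=
        (Finset.card_le_card hsub).trans (Finset.card_image₂_le _ _ _)
    _ ≤ (C * (n + 1) ^ V) * (C' * (n + 1) ^ V') := Nat.mul_le_mul (h n z) (h' n z)
    _ = C * C' * (n + 1) ^ (V + V') := by ring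

theorem PolyGrowth.or {P Q : Z → Θ → Prop} (hP : PolyGrowth P) (hQ : PolyGrowth Q) :
    PolyGrowth fun z θ => P z θ ∨ Q z θ :=
  (hP.not.and hQ.not).not.of_iff fun z θ => by tauto

theorem PolyGrowth.finset_exists {ι : Type*} (s : Finset ι) {P : ι → Z → Θ → Prop}
    (hP : ∀ i, PolyGrowth (P i)) : PolyGrowth fun z θ => ∃ i ∈ s, P i z θ := by
  classical
  induction s using Finset.induction_on with
  | empty => exact (PolyGrowth.const fun _ => False).of_iff fun z θ => by simp
  | insert a s _ ih => exact ((hP a).or ih).of_iff fun z θ => by simp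

theorem PolyGrowth.exists {ι : Type*} [Fintype ι] {P : ι → Z → Θ → Prop}
    (hP : ∀ i, PolyGrowth (P i)) : PolyGrowth fun z θ => ∃ i, P i z θ :=
  (PolyGrowth.finset_exists Finset.univ hP).of_iff fun z θ => by simp

theorem PolyGrowth.forall {ι : Type*} [Fintype ι] {P : ι → Z → Θ → Prop}
    (hP : ∀ i, PolyGrowth (P i)) : PolyGrowth fun z θ => ∀ i, P i z θ :=
  (PolyGrowth.exists fun i => (hP i).not).not.of_iff fun z θ => by simp

end Growth

/-! ### Finite rank families -/

section FinRank

variable {Z Z' Θ : Type*}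

/-- A family of functions spanned by finitely many functions, with coefficients depending on
the index of the family. -/
def FinRank (f : Z → Θ → ℝ) : Prop :=
  ∃ (ι : Type) (_ : Fintype ι) (a : ι → Z → ℝ) (g : ι → Θ → ℝ),
    ∀ z θ, f z θ = ∑ j, a j z * g j θ

theorem FinRank.comap {f : Z → Θ → ℝ} (hf : FinRank f) (φ : Z' → Z) :
    FinRank fun z θ => f (φ z) θ := by
  obtain ⟨ι, _, a, g, h⟩ := hf
  exact ⟨ι, inferInstance, fun j z => a j (φ z), g, fun z θ => h (φ z) θ⟩

theorem FinRank.index (a : Z → ℝ) : FinRank fun z (_ : Θ) => a z :=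
  ⟨Unit, inferInstance, fun _ => a, fun _ _ => 1, fun z θ => by simp⟩

theorem FinRank.param (g : Θ → ℝ) : FinRank fun (_ : Z) θ => g θ :=
  ⟨Unit, inferInstance, fun _ _ => 1, fun _ => g, fun z θ => by simp⟩

theorem FinRank.add {f g : Z → Θ → ℝ} (hf : FinRank f) (hg : FinRank g) :
    FinRank fun z θ => f z θ + g z θ := by
  obtain ⟨ι, _, a, u, h⟩ := hf
  obtain ⟨κ, _, b, v, h'⟩ := hg
  exact ⟨ι ⊕ κ, inferInstance, Sum.elim a b, Sum.elim u v, fun z θ => by simp [h, h']⟩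

/-- Products of the spanning functions span the product. Only the number of spanning functions
matters, so no polynomial degree has to be tracked. -/
theorem FinRank.mul {f g : Z → Θ → ℝ} (hf : FinRank f) (hg : FinRank g) :
    FinRank fun z θ => f z θ * g z θ := by
  obtain ⟨ι, _, a, u, h⟩ := hf
  obtain ⟨κ, _, b, v, h'⟩ := hg
  refine ⟨ι × κ, inferInstance, fun p z => a p.1 z * b p.2 z, fun p θ => u p.1 θ * v p.2 θ,
    fun z θ => ?_⟩
  simp only [h, h']
  rw [Finset.sum_mul_sum, Fintype.sum_prod_type]
  exact Finset.sum_congr rfl fun i _ => Finset.sum_congr rfl fun j _ => by ring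

/-- A set shattered by the positivity sets of a space of functions of dimension `k` has at most
`k` elements. -/
theorem card_le_of_shatters_pos {ι : Type*} [Fintype ι] {n : ℕ} (a : ι → Fin n → ℝ)
    (g : ι → Θ → ℝ) {S : Finset (Fin n)}
    (hS : (traces (fun i θ => 0 < ∑ j, a j i * g j θ) (id : Fin n → Fin n)).Shatters S) :
    S.card ≤ Fintype.card ι := by
  classical
  by_contra! hcard
  have hdep : ¬ LinearIndependent ℝ fun (i : S) (j : ι) => a j i := by
    intro hli
    have := hli.fintype_card_le_finrank
    simp only [Fintype.card_coe, Module.finrank_fintype_fun_eq_card] at this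
    omega
  -- A nontrivial relation has a nonzero coefficient; changing all signs if necessary makes one
  -- positive.
  obtain ⟨w, hw, hne⟩ : ∃ w : S → ℝ, (∑ i, w i • fun j : ι => a j i) = 0 ∧ ∃ i, 0 < w i := by
    obtain ⟨w, hw, i, hi⟩ := Fintype.not_linearIndependent_iff.1 hdep
    rcases lt_or_gt_of_ne hi with h | h
    · exact ⟨-w, by simpa using hw, i, by simpa using h⟩
    · exact ⟨w, hw, i, h⟩
  -- Shattering yields a `θ` whose function is positive on `S` exactly where `w` is. Every term of
  -- the relation is then nonnegative and one is positive, although their sum is zero.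
  obtain ⟨B, hB, hBS⟩ := hS (t := S.filter fun i => ∃ h : i ∈ S, 0 < w ⟨i, h⟩)
    (Finset.filter_subset _ _)
  obtain ⟨θ, hθ⟩ := mem_traces.1 hB
  have hpos : ∀ i : S, 0 < w i ↔ 0 < ∑ j, a j i * g j θ := by
    intro i
    have h1 := Finset.ext_iff.1 hBS i
    have h2 := hθ i
    simp only [Finset.mem_inter, i.2, true_and, Finset.mem_filter, Subtype.coe_eta, id,
      exists_true_left] at h1 h2
    exact h1.symm.trans h2
  have hzero : ∑ i : S, w i * ∑ j, a j i * g j θ = 0 := by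
    have : ∀ j, ∑ i : S, w i * a j i = 0 := fun j => by simpa using congrFun hw j
    calc ∑ i : S, w i * ∑ j, a j i * g j θ
        = ∑ j, (∑ i : S, w i * a j i) * g j θ := by
          simp only [Finset.mul_sum, Finset.sum_mul]
          rw [Finset.sum_comm]
          exact Finset.sum_congr rfl fun i _ => Finset.sum_congr rfl fun j _ => by ring
      _ = 0 := Finset.sum_eq_zero fun j _ => by rw [this, zero_mul]
  have hnonneg : ∀ i : S, 0 ≤ w i * ∑ j, a j i * g j θ := by
    intro i
    by_cases hi : 0 < w i
    · exact mul_nonneg hi.le ((hpos i).1 hi).le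
    · exact mul_nonneg_of_nonpos_of_nonpos (not_lt.1 hi) (not_lt.1 fun h => hi ((hpos i).2 h))
  obtain ⟨i, hi⟩ := hne
  have := (Finset.sum_eq_zero_iff_of_nonneg fun i _ => hnonneg i).1 hzero i (Finset.mem_univ _)
  exact (mul_pos hi ((hpos i).1 hi)).ne' this

theorem sum_choose_le_pow (n k : ℕ) : ∑ i ∈ Finset.Iic k, n.choose i ≤ (n + 1) ^ k := by
  have hI : Finset.Iic k = Finset.range (k + 1) := by
    ext i
    simp
  rw [hI, add_pow]
  refine Finset.sum_le_sum fun i hi => ?_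
  have hik : i ≤ k := Nat.lt_succ_iff.1 (Finset.mem_range.1 hi)
  calc n.choose i ≤ n ^ i := Nat.choose_le_pow n i
    _ ≤ n ^ i * 1 ^ (k - i) * k.choose i := by
      rw [one_pow, mul_one]
      exact Nat.le_mul_of_pos_right _ (Nat.choose_pos hik)

/-- Sauer–Shelah: the VC dimension is at most the number of spanning functions, which becomes the
growth exponent. -/
theorem FinRank.polyGrowth_pos {f : Z → Θ → ℝ} (hf : FinRank f) :
    PolyGrowth fun z θ => 0 < f z θ := by
  classical
  obtain ⟨ι, _, a, g, h⟩ := hf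
  refine ⟨1, Fintype.card ι, fun n z => ?_⟩
  rw [one_mul]
  have heq : traces (fun z θ => 0 < f z θ) z =
      traces (fun i θ => 0 < ∑ j, a j (z i) * g j θ) (id : Fin n → Fin n) := by
    ext A
    simp [mem_traces, h]
  rw [heq]
  set 𝒜 := traces (fun i θ => 0 < ∑ j, a j (z i) * g j θ) (id : Fin n → Fin n) with h𝒜
  have hvc : 𝒜.vcDim ≤ Fintype.card ι := by
    refine Finset.sup_le fun S hS => ?_
    exact card_le_of_shatters_pos (fun j i => a j (z i)) g (Finset.mem_shatterer.1 hS)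
  calc 𝒜.card ≤ 𝒜.shatterer.card := Finset.card_le_card_shatterer 𝒜
    _ ≤ ∑ k ∈ Finset.Iic 𝒜.vcDim, (Fintype.card (Fin n)).choose k :=
      Finset.card_shatterer_le_sum_vcDim
    _ ≤ (n + 1) ^ 𝒜.vcDim := by
      rw [Fintype.card_fin]
      exact sum_choose_le_pow n _
    _ ≤ (n + 1) ^ Fintype.card ι := Nat.pow_le_pow_right (Nat.succ_pos n) hvc

end FinRank

/-! ### Piecewise finite rank families -/

section Tame

variable {Z Z' Θ : Type*}

/-- A family of functions which agrees with one of finitely many finite rank families on each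
of finitely many pieces of polynomial growth. -/
def Tame (f : Z → Θ → ℝ) : Prop :=
  ∃ (ι : Type) (_ : Fintype ι) (P : ι → Z → Θ → Prop) (F : ι → Z → Θ → ℝ),
    (∀ b, PolyGrowth (P b)) ∧ (∀ b, FinRank (F b)) ∧
      (∀ z θ, ∃ b, P b z θ) ∧ ∀ b z θ, P b z θ → f z θ = F b z θ

theorem FinRank.tame {f : Z → Θ → ℝ} (hf : FinRank f) : Tame f :=
  ⟨Unit, inferInstance, fun _ _ _ => True, fun _ => f, fun _ => PolyGrowth.const _, fun _ => hf,
    fun _ _ => ⟨(), trivial⟩, fun _ _ _ _ => rfl⟩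

theorem Tame.index (a : Z → ℝ) : Tame fun z (_ : Θ) => a z := (FinRank.index a).tame

theorem Tame.param (g : Θ → ℝ) : Tame fun (_ : Z) θ => g θ := (FinRank.param g).tame

theorem Tame.comap {f : Z → Θ → ℝ} (hf : Tame f) (φ : Z' → Z) :
    Tame fun z θ => f (φ z) θ := by
  obtain ⟨ι, _, P, F, hP, hF, hex, hfF⟩ := hf
  exact ⟨ι, inferInstance, fun b z θ => P b (φ z) θ, fun b z θ => F b (φ z) θ,
    fun b => (hP b).comap φ, fun b => (hF b).comap φ, fun z θ => hex (φ z) θ,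
    fun b z θ => hfF b (φ z) θ⟩

theorem Tame.add {f g : Z → Θ → ℝ} (hf : Tame f) (hg : Tame g) :
    Tame fun z θ => f z θ + g z θ := by
  obtain ⟨ι, _, P, F, hP, hF, hex, hfF⟩ := hf
  obtain ⟨κ, _, Q, G, hQ, hG, hex', hgG⟩ := hg
  refine ⟨ι × κ, inferInstance, fun b z θ => P b.1 z θ ∧ Q b.2 z θ,
    fun b z θ => F b.1 z θ + G b.2 z θ, fun b => (hP b.1).and (hQ b.2),
    fun b => (hF b.1).add (hG b.2), fun z θ => ?_, fun b z θ h => ?_⟩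
  · obtain ⟨b, hb⟩ := hex z θ
    obtain ⟨b', hb'⟩ := hex' z θ
    exact ⟨(b, b'), hb, hb'⟩
  · simp only [hfF _ _ _ h.1, hgG _ _ _ h.2]

theorem Tame.mul {f g : Z → Θ → ℝ} (hf : Tame f) (hg : Tame g) :
    Tame fun z θ => f z θ * g z θ := by
  obtain ⟨ι, _, P, F, hP, hF, hex, hfF⟩ := hf
  obtain ⟨κ, _, Q, G, hQ, hG, hex', hgG⟩ := hg
  refine ⟨ι × κ, inferInstance, fun b z θ => P b.1 z θ ∧ Q b.2 z θ,
    fun b z θ => F b.1 z θ * G b.2 z θ, fun b => (hP b.1).and (hQ b.2),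
    fun b => (hF b.1).mul (hG b.2), fun z θ => ?_, fun b z θ h => ?_⟩
  · obtain ⟨b, hb⟩ := hex z θ
    obtain ⟨b', hb'⟩ := hex' z θ
    exact ⟨(b, b'), hb, hb'⟩
  · simp only [hfF _ _ _ h.1, hgG _ _ _ h.2]

-- The closure property for which pieces are allowed: a test of polynomial growth may decide between
-- tame families, as removing duplicates requires.
open Classical in
theorem Tame.ite {p : Z → Θ → Prop} {f g : Z → Θ → ℝ} (hp : PolyGrowth p) (hf : Tame f)
    (hg : Tame g) : Tame fun z θ => if p z θ then f z θ else g z θ := by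
  obtain ⟨ι, _, P, F, hP, hF, hex, hfF⟩ := hf
  obtain ⟨κ, _, Q, G, hQ, hG, hex', hgG⟩ := hg
  refine ⟨ι ⊕ κ, inferInstance,
    Sum.elim (fun b z θ => p z θ ∧ P b z θ) (fun b z θ => ¬ p z θ ∧ Q b z θ), Sum.elim F G,
    ?_, ?_, fun z θ => ?_, ?_⟩
  · rintro (b | b)
    · exact hp.and (hP b)
    · exact hp.not.and (hQ b)
  · rintro (b | b)
    · exact hF b
    · exact hG b
  · by_cases h : p z θ
    · obtain ⟨b, hb⟩ := hex z θ
      exact ⟨Sum.inl b, h, hb⟩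
    · obtain ⟨b, hb⟩ := hex' z θ
      exact ⟨Sum.inr b, h, hb⟩
  · rintro (b | b) z θ ⟨h, hb⟩
    · simpa [h] using hfF b z θ hb
    · simpa [h] using hgG b z θ hb

theorem Tame.neg {f : Z → Θ → ℝ} (hf : Tame f) : Tame fun z θ => -f z θ := by
  simpa using (Tame.index fun _ => (-1 : ℝ)).mul hf

theorem Tame.sub {f g : Z → Θ → ℝ} (hf : Tame f) (hg : Tame g) :
    Tame fun z θ => f z θ - g z θ := by
  simpa [sub_eq_add_neg] using hf.add hg.neg

theorem Tame.sq {f : Z → Θ → ℝ} (hf : Tame f) : Tame fun z θ => f z θ ^ 2 := by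
  simpa [_root_.sq] using hf.mul hf

theorem Tame.sum {ι : Type*} (s : Finset ι) {f : ι → Z → Θ → ℝ} (hf : ∀ i, Tame (f i)) :
    Tame fun z θ => ∑ i ∈ s, f i z θ := by
  classical
  induction s using Finset.induction_on with
  | empty => simpa using Tame.index fun _ : Z => (0 : ℝ)
  | insert a s ha ih => simpa [Finset.sum_insert ha] using (hf a).add ih

theorem Tame.polyGrowth_pos {f : Z → Θ → ℝ} (hf : Tame f) :
    PolyGrowth fun z θ => 0 < f z θ := by
  obtain ⟨ι, _, P, F, hP, hF, hex, hfF⟩ := hf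
  refine (PolyGrowth.exists fun b => (hP b).and (hF b).polyGrowth_pos).of_iff fun z θ => ?_
  constructor
  · intro h
    obtain ⟨b, hb⟩ := hex z θ
    exact ⟨b, hb, hfF b z θ hb ▸ h⟩
  · rintro ⟨b, hb, h⟩
    rwa [hfF b z θ hb]

theorem Tame.polyGrowth_lt {f g : Z → Θ → ℝ} (hf : Tame f) (hg : Tame g) :
    PolyGrowth fun z θ => f z θ < g z θ :=
  (hg.sub hf).polyGrowth_pos.of_iff fun _ _ => sub_pos.symm

theorem Tame.polyGrowth_eq {f g : Z → Θ → ℝ} (hf : Tame f) (hg : Tame g) :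
    PolyGrowth fun z θ => f z θ = g z θ :=
  ((hf.polyGrowth_lt hg).or (hg.polyGrowth_lt hf)).not.of_iff fun z θ => by
    rw [← ne_iff_lt_or_gt, not_not]

theorem Tame.abs {f : Z → Θ → ℝ} (hf : Tame f) : Tame fun z θ => |f z θ| := by
  classical
  have h := Tame.ite hf.polyGrowth_pos hf hf.neg
  have heq : (fun z θ => |f z θ|) = fun z θ => if 0 < f z θ then f z θ else -f z θ := by
    funext z θ
    split_ifs with h
    · exact abs_of_pos h
    · exact abs_of_nonpos (not_lt.1 h)
  rw [heq]
  convert h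

end Tame

/-! ### Rademacher averages -/

section Rademacher

/-- The sign encoded by a Boolean. -/
def rsign (b : Bool) : ℝ := if b then 1 else -1

/-- The average over uniform signs. -/
noncomputable def signAvg {N : ℕ} (X : (Fin N → Bool) → ℝ) : ℝ := (2 ^ N : ℝ)⁻¹ * ∑ σ, X σ

variable {N : ℕ}

theorem signAvg_add (X Y : (Fin N → Bool) → ℝ) :
    signAvg (fun σ => X σ + Y σ) = signAvg X + signAvg Y := by
  simp [signAvg, Finset.sum_add_distrib, mul_add]

theorem signAvg_const (a : ℝ) : signAvg (fun _ : Fin N → Bool => a) = a := by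
  simp [signAvg]

theorem signAvg_const_mul (a : ℝ) (X : (Fin N → Bool) → ℝ) :
    signAvg (fun σ => a * X σ) = a * signAvg X := by
  simp only [signAvg, ← Finset.mul_sum]
  ring

theorem signAvg_sum {ι : Type*} (s : Finset ι) (X : ι → (Fin N → Bool) → ℝ) :
    signAvg (fun σ => ∑ j ∈ s, X j σ) = ∑ j ∈ s, signAvg (X j) := by
  simp only [signAvg, ← Finset.mul_sum]
  rw [Finset.sum_comm]

theorem signAvg_mono {X Y : (Fin N → Bool) → ℝ} (h : ∀ σ, X σ ≤ Y σ) :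
    signAvg X ≤ signAvg Y :=
  mul_le_mul_of_nonneg_left (Finset.sum_le_sum fun σ _ => h σ) (by positivity)

theorem exp_signAvg_le (X : (Fin N → Bool) → ℝ) :
    Real.exp (signAvg X) ≤ signAvg fun σ => Real.exp (X σ) := by
  have h := convexOn_exp.map_sum_le (t := (Finset.univ : Finset (Fin N → Bool)))
    (w := fun _ => (2 ^ N : ℝ)⁻¹) (p := X) (fun _ _ => by positivity)
    (by simp) (fun _ _ => Set.mem_univ _)
  simpa [signAvg, Finset.mul_sum] using h

/-- Independence of the signs factors the average into `cosh (v i)`, and `cosh x ≤ exp (x²/2)`. -/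
theorem signAvg_exp_le (v : Fin N → ℝ) :
    signAvg (fun σ => Real.exp (∑ i, rsign (σ i) * v i)) ≤ Real.exp ((∑ i, v i ^ 2) / 2) := by
  have h : ∑ σ : Fin N → Bool, Real.exp (∑ i, rsign (σ i) * v i) =
      ∏ i, ∑ b : Bool, Real.exp (rsign b * v i) := by
    rw [Fintype.prod_sum]
    exact Finset.sum_congr rfl fun σ _ => Real.exp_sum _ _
  have h2 : ∀ i, ∑ b : Bool, Real.exp (rsign b * v i) = 2 * Real.cosh (v i) := fun i => by
    simp only [rsign, Fintype.sum_bool, if_true, Bool.false_eq_true, if_false, Real.cosh_eq]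
    ring_nf
  rw [signAvg, h, Finset.prod_congr rfl fun i _ => h2 i, Finset.prod_mul_distrib,
    Finset.prod_const, Finset.card_univ, Fintype.card_fin, ← mul_assoc,
    inv_mul_cancel₀ (by positivity), one_mul, Finset.sum_div, Real.exp_sum]
  exact Finset.prod_le_prod (fun i _ => (Real.cosh_pos _).le)
    fun i _ => Real.cosh_le_exp_half_sq _

/-- Massart's finite class lemma, for a sign-dependent selection from a finite class. -/
theorem massart (𝒱 : Finset (Fin N → ℝ)) (v : (Fin N → Bool) → Fin N → ℝ) {r K t : ℝ}
    (hv : ∀ σ, v σ ∈ 𝒱) (hr : ∀ w ∈ 𝒱, ∑ i, w i ^ 2 ≤ r) (hK : (𝒱.card : ℝ) ≤ K)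
    (ht : 0 < t) :
    signAvg (fun σ => ∑ i, rsign (σ i) * v σ i) ≤ Real.log K / t + t * r / 2 := by
  have hpos : (0 : ℝ) < 𝒱.card := by
    exact_mod_cast Finset.card_pos.2 ⟨_, hv fun _ => true⟩
  have key : Real.exp (t * signAvg fun σ => ∑ i, rsign (σ i) * v σ i) ≤
      Real.exp (Real.log K + t ^ 2 * r / 2) := by
    rw [← signAvg_const_mul]
    refine (exp_signAvg_le _).trans ?_
    calc signAvg (fun σ => Real.exp (t * ∑ i, rsign (σ i) * v σ i))
        ≤ signAvg (fun σ => ∑ w ∈ 𝒱, Real.exp (∑ i, rsign (σ i) * (t * w i))) := by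
          refine signAvg_mono fun σ => ?_
          have : t * ∑ i, rsign (σ i) * v σ i = ∑ i, rsign (σ i) * (t * v σ i) := by
            rw [Finset.mul_sum]
            exact Finset.sum_congr rfl fun i _ => by ring
          rw [this]
          exact Finset.single_le_sum
            (f := fun w : Fin N → ℝ => Real.exp (∑ i, rsign (σ i) * (t * w i)))
            (fun w _ => (Real.exp_pos _).le) (hv σ)
      _ = ∑ w ∈ 𝒱, signAvg (fun σ => Real.exp (∑ i, rsign (σ i) * (t * w i))) :=
          signAvg_sum _ _
      _ ≤ ∑ w ∈ 𝒱, Real.exp (t ^ 2 * r / 2) := by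
          refine Finset.sum_le_sum fun w hw => (signAvg_exp_le _).trans (Real.exp_le_exp.2 ?_)
          have := mul_le_mul_of_nonneg_left (hr w hw) (sq_nonneg t)
          simp only [mul_pow, ← Finset.mul_sum]
          linarith
      _ = 𝒱.card * Real.exp (t ^ 2 * r / 2) := by simp
      _ ≤ K * Real.exp (t ^ 2 * r / 2) := by gcongr
      _ = Real.exp (Real.log K + t ^ 2 * r / 2) := by
          rw [Real.exp_add, Real.exp_log (hpos.trans_le hK)]
  have := Real.exp_le_exp.1 key
  rw [div_add' _ _ _ ht.ne', le_div_iff₀ ht]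
  linarith

theorem massart_sqrt (𝒱 : Finset (Fin N → ℝ)) (v : (Fin N → Bool) → Fin N → ℝ) {r L : ℝ}
    (hv : ∀ σ, v σ ∈ 𝒱) (hr : ∀ w ∈ 𝒱, ∑ i, w i ^ 2 ≤ r)
    (hL : Real.log 𝒱.card ≤ L) (hL0 : 0 < L) (hr0 : 0 < r) :
    signAvg (fun σ => ∑ i, rsign (σ i) * v σ i) ≤ Real.sqrt (2 * r * L) := by
  have hpos : (0 : ℝ) < 𝒱.card := by
    exact_mod_cast Finset.card_pos.2 ⟨_, hv fun _ => true⟩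
  set s := Real.sqrt (2 * r * L) with hs
  have hs0 : 0 < s := Real.sqrt_pos.2 (by positivity)
  have hss : s * s = 2 * r * L := Real.mul_self_sqrt (by positivity)
  -- The choice `t = √(2L/r)` balances the two terms of `massart`; each equals `s / 2`.
  have h := massart 𝒱 v hv hr ((Real.log_le_iff_le_exp hpos).1 hL) (t := s / r) (by positivity)
  rw [Real.log_exp] at h
  have h1 : L / (s / r) = s / 2 := by
    field_simp
    linarith
  have h2 : s / r * r / 2 = s / 2 := by
    field_simp
  linarith

end Rademacher

/-! ### Classes of polynomial growth -/

section Chaining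

variable {Z Θ : Type*}

open Classical in
/-- The number of points on which the predicates given by `θ` and `θ'` differ. -/
noncomputable def disagree (P : Z → Θ → Prop) {N : ℕ} (z : Fin N → Z) (θ θ' : Θ) :
    Finset (Fin N) :=
  Finset.univ.filter fun i => ¬ (P (z i) θ ↔ P (z i) θ')

/-- In a class of polynomial growth, the size of families with pairwise disagreement on a fixed
proportion of the points is bounded independently of the number of points. -/
theorem PolyGrowth.separated_bound {P : Z → Θ → Prop} (hP : PolyGrowth P) {ε : ℝ} (hε : 0 < ε)
    (hε1 : ε ≤ 1) :
    ∃ K : ℕ, ∀ (N : ℕ) (_ : 0 < N) (z : Fin N → Z) (S : Finset Θ),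
      (∀ θ ∈ S, ∀ θ' ∈ S, θ ≠ θ' → ε * N < (disagree P z θ θ').card) → S.card ≤ K := by
  classical
  obtain ⟨C, V, h⟩ := hP
  -- A sample size depending only on the growth and on `ε`, for which the exponential decay beats
  -- the square of the number of traces.
  obtain ⟨n, hn⟩ : ∃ n : ℕ, ((C * (n + 1) ^ V + 1 : ℕ) : ℝ) ^ 2 * (1 - ε) ^ n < 1 := by
    have hlim : Filter.Tendsto
        (fun n : ℕ => ((C + 1 : ℝ) * 2 ^ V) ^ 2 * ((n : ℝ) ^ (V * 2) * (1 - ε) ^ n))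
        Filter.atTop (nhds (((C + 1 : ℝ) * 2 ^ V) ^ 2 * 0)) :=
      (tendsto_pow_const_mul_const_pow_of_abs_lt_one (V * 2)
        (by rw [abs_lt]; constructor <;> linarith)).const_mul _
    rw [mul_zero] at hlim
    obtain ⟨n, hn, hn1⟩ := ((hlim.eventually_lt_const one_pos).and
      (Filter.eventually_ge_atTop 1)).exists
    refine ⟨n, lt_of_le_of_lt ?_ hn⟩
    have hn1' : (1 : ℝ) ≤ n := by exact_mod_cast hn1
    have h0 : (0 : ℝ) ≤ (1 - ε) ^ n := pow_nonneg (by linarith) n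
    have h1 : ((C * (n + 1) ^ V + 1 : ℕ) : ℝ) ≤ (C + 1 : ℝ) * 2 ^ V * (n : ℝ) ^ V := by
      have h2 : ((n : ℝ) + 1) ^ V ≤ (2 * n) ^ V := by gcongr; linarith
      have h3 : (1 : ℝ) ≤ (2 * n) ^ V := one_le_pow₀ (by linarith)
      rw [mul_pow] at h2 h3
      push_cast
      nlinarith [Nat.cast_nonneg (α := ℝ) C]
    calc ((C * (n + 1) ^ V + 1 : ℕ) : ℝ) ^ 2 * (1 - ε) ^ n
        ≤ ((C + 1 : ℝ) * 2 ^ V * (n : ℝ) ^ V) ^ 2 * (1 - ε) ^ n := by gcongr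
      _ = ((C + 1 : ℝ) * 2 ^ V) ^ 2 * ((n : ℝ) ^ (V * 2) * (1 - ε) ^ n) := by ring
  refine ⟨C * (n + 1) ^ V, fun N hN z S hS => ?_⟩
  by_contra! hcard
  obtain ⟨S', hS', hc⟩ := Finset.exists_subset_card_eq hcard
  have hN' : (0 : ℝ) < N := by exact_mod_cast hN
  -- The samples of `n` points on which two parameters cannot be told apart. For a separated pair
  -- they form a fraction of at most `(1 - ε)^n` of all samples, so a union bound over pairs leaves
  -- a sample that distinguishes all of `S'`.
  let bad : Θ × Θ → Finset (Fin n → Fin N) := fun p =>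
    Fintype.piFinset fun _ => (disagree P z p.1 p.2)ᶜ
  have hbad : ∀ p ∈ S'.offDiag, ((bad p).card : ℝ) ≤ ((1 - ε) * N) ^ n := by
    intro p hp
    obtain ⟨h1, h2, h3⟩ := Finset.mem_offDiag.1 hp
    have := hS _ (hS' h1) _ (hS' h2) h3
    rw [Fintype.card_piFinset]
    simp only [Finset.prod_const, Finset.card_univ, Fintype.card_fin, Nat.cast_pow]
    gcongr
    rw [Finset.card_compl, Fintype.card_fin, Nat.cast_sub (card_finset_fin_le _)]
    linarith
  have hlt : (S'.offDiag.biUnion bad).card < (Finset.univ : Finset (Fin n → Fin N)).card := by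
    rw [← Nat.cast_lt (α := ℝ)]
    calc ((S'.offDiag.biUnion bad).card : ℝ) ≤ ∑ p ∈ S'.offDiag, ((bad p).card : ℝ) := by
          exact_mod_cast Finset.card_biUnion_le
      _ ≤ ∑ p ∈ S'.offDiag, ((1 - ε) * N) ^ n := Finset.sum_le_sum hbad
      _ = S'.offDiag.card * ((1 - ε) * N) ^ n := by simp
      _ ≤ ((C * (n + 1) ^ V + 1 : ℕ) : ℝ) ^ 2 * ((1 - ε) * N) ^ n := by
          have h0 : 0 ≤ (1 - ε) * (N : ℝ) := mul_nonneg (by linarith) hN'.le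
          gcongr
          rw [Finset.offDiag_card, hc, ← sq]
          exact_mod_cast Nat.sub_le _ _
      _ = ((C * (n + 1) ^ V + 1 : ℕ) : ℝ) ^ 2 * (1 - ε) ^ n * (N : ℝ) ^ n := by
          rw [mul_pow]; ring
      _ < 1 * (N : ℝ) ^ n := by gcongr
      _ = ((Finset.univ : Finset (Fin n → Fin N)).card : ℝ) := by simp
  obtain ⟨x, -, hx⟩ := Finset.exists_mem_notMem_of_card_lt_card hlt
  -- On this sample the members of `S'` have distinct traces, one more than the growth bound
  -- permits.
  have hinj : Set.InjOn (fun θ => Finset.univ.filter fun i => P (z (x i)) θ) (S' : Set Θ) := by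
    intro θ hθ θ' hθ' heq
    by_contra hne
    refine hx (Finset.mem_biUnion.2 ⟨(θ, θ'), Finset.mem_offDiag.2 ⟨hθ, hθ', hne⟩, ?_⟩)
    refine Fintype.mem_piFinset.2 fun i => ?_
    have := Finset.ext_iff.1 heq i
    simpa [disagree] using this
  have := Finset.card_le_card_of_injOn (t := traces P fun i => z (x i)) _
    (fun θ _ => mem_traces.2 ⟨θ, by simp⟩) hinj
  have := h n fun i => z (x i)
  omega

/-- A class of polynomial growth has nets in normalized Hamming distance whose size is
independent of the number of points. -/
theorem PolyGrowth.exists_net {P : Z → Θ → Prop} (hP : PolyGrowth P) {ε : ℝ} (hε : 0 < ε)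
    (hε1 : ε ≤ 1) :
    ∃ K : ℕ, ∀ (N : ℕ) (_ : 0 < N) (z : Fin N → Z), ∃ S : Finset Θ, S.card ≤ K ∧
      ∀ θ, ∃ θ' ∈ S, ((disagree P z θ θ').card : ℝ) ≤ ε * N := by
  classical
  obtain ⟨K, hK⟩ := hP.separated_bound hε hε1
  refine ⟨K, fun N hN z => ?_⟩
  let sep : Finset Θ → Prop := fun S =>
    ∀ θ ∈ S, ∀ θ' ∈ S, θ ≠ θ' → ε * N < (disagree P z θ θ').card
  have hbdd : BddAbove {k | ∃ S, sep S ∧ S.card = k} :=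
    ⟨K, by rintro k ⟨S, hS, rfl⟩; exact hK N hN z S hS⟩
  -- A separated family of maximal size is a net, since a parameter far from all its members could
  -- be added.
  obtain ⟨S, hS, hmax⟩ := Nat.sSup_mem (s := {k | ∃ S, sep S ∧ S.card = k})
    ⟨0, ∅, by simp [sep], rfl⟩ hbdd
  refine ⟨S, hK N hN z S hS, fun θ => ?_⟩
  by_contra! hfar
  have hθ : θ ∉ S := fun h => by
    have := hfar θ h
    simp only [disagree, not_true_eq_false, Finset.filter_false, Finset.card_empty,
      Nat.cast_zero] at this
    exact absurd this (not_lt.2 (by positivity))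
  have hcomm : ∀ a b, disagree P z a b = disagree P z b a := fun a b => by
    simp only [disagree]
    congr 1
    funext i
    rw [iff_comm]
  have hins : sep (insert θ S) := by
    intro a ha b hb hab
    rcases Finset.mem_insert.1 ha with rfl | ha'
    · rcases Finset.mem_insert.1 hb with rfl | hb'
      · exact absurd rfl hab
      · exact hfar b hb'
    · rcases Finset.mem_insert.1 hb with rfl | hb'
      · rw [hcomm]
        exact hfar a ha'
      · exact hS a ha' b hb' hab
  have := le_csSup hbdd ⟨insert θ S, hins, rfl⟩
  rw [← hmax, Finset.card_insert_of_notMem hθ] at this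
  omega

open Classical in
/-- The indicator vector of `P · θ` on the points `z`. -/
noncomputable def indVec (P : Z → Θ → Prop) {N : ℕ} (z : Fin N → Z) (θ : Θ) : Fin N → ℝ :=
  fun i => if P (z i) θ then 1 else 0

/-- The Rademacher averages of a class of polynomial growth, up to a logarithm with a small
absolute coefficient. -/
theorem PolyGrowth.rademacher {P : Z → Θ → Prop} (hP : PolyGrowth P) :
    ∃ K : ℝ, 0 ≤ K ∧ ∀ (N : ℕ) (_ : 0 < N) (z : Fin N → Z) (θ : (Fin N → Bool) → Θ),
      signAvg (fun σ => ∑ i, rsign (σ i) * indVec P z (θ σ) i) ≤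
        Real.sqrt N * Real.sqrt (K + 4 * Real.log N) := by
  classical
  obtain ⟨C, V, h⟩ := id hP
  have hV : (0 : ℝ) < V + 1 := by positivity
  -- The radius is tied to the growth exponent: the fine scale then contributes `V/(V+1) · log N ≤
  -- log N`.
  obtain ⟨k, hk⟩ := hP.exists_net (ε := 1 / (V + 1)) (by positivity)
    (by rw [div_le_one hV]; linarith [Nat.cast_nonneg (α := ℝ) V])
  set L₁ : ℝ := Real.log (k + 1) + 1 with hL₁
  set L₀ : ℝ := Real.log (C + 1) + V * Real.log 2 + 1 with hL₀
  have hL₁0 : 0 < L₁ := by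
    have := Real.log_nonneg (x := (k : ℝ) + 1) (by linarith [Nat.cast_nonneg (α := ℝ) k])
    linarith
  have hL₀0 : 0 < L₀ := by
    have := Real.log_nonneg (x := (C : ℝ) + 1) (by linarith [Nat.cast_nonneg (α := ℝ) C])
    have := Real.log_nonneg (x := (2 : ℝ)) (by norm_num)
    positivity
  refine ⟨4 * L₁ + 4 * L₀, by positivity, fun N hN z θ => ?_⟩
  have hN1 : (1 : ℝ) ≤ N := by exact_mod_cast hN
  have hlogN : 0 ≤ Real.log N := Real.log_nonneg hN1
  obtain ⟨S, hSk, hS⟩ := hk N hN z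
  choose π hπS hπ using hS
  -- a canonical parameter for each trace, so that the remainders form a small finite class
  let θ₀ : Θ := θ fun _ => true
  have hrep : ∀ A : Finset (Fin N), ∃ θ', A ∈ traces P z → ∀ i, i ∈ A ↔ P (z i) θ' := by
    intro A
    by_cases hA : A ∈ traces P z
    · obtain ⟨θ', hθ'⟩ := mem_traces.1 hA
      exact ⟨θ', fun _ => hθ'⟩
    · exact ⟨θ₀, fun h => absurd h hA⟩
  choose rep hrep using hrep
  let tr : Θ → Finset (Fin N) := fun θ => Finset.univ.filter fun i => P (z i) θ
  have htr : ∀ θ, tr θ ∈ traces P z := fun θ => mem_traces.2 ⟨θ, by simp [tr]⟩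
  have hind : ∀ θ, indVec P z θ = indVec P z (rep (tr θ)) := by
    intro θ
    funext i
    have := hrep _ (htr θ) i
    simp only [tr, Finset.mem_filter, Finset.mem_univ, true_and] at this
    simp only [indVec, tr, this]
  let rem : Finset (Fin N) → Fin N → ℝ := fun A i =>
    indVec P z (rep A) i - indVec P z (π (rep A)) i
  have hdecomp : (fun σ => ∑ i, rsign (σ i) * indVec P z (θ σ) i) = fun σ =>
      (∑ i, rsign (σ i) * indVec P z (π (rep (tr (θ σ)))) i) +
        ∑ i, rsign (σ i) * rem (tr (θ σ)) i := by
    funext σ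
    rw [← Finset.sum_add_distrib]
    refine Finset.sum_congr rfl fun i _ => ?_
    rw [hind (θ σ)]
    simp only [rem]
    ring
  have hcoarse : signAvg (fun σ => ∑ i, rsign (σ i) * indVec P z (π (rep (tr (θ σ)))) i) ≤
      Real.sqrt (2 * N * L₁) := by
    refine massart_sqrt (S.image (indVec P z)) _
      (fun σ => Finset.mem_image_of_mem _ (hπS _)) ?_ ?_ hL₁0 (by linarith)
    · intro w hw
      obtain ⟨θ', -, rfl⟩ := Finset.mem_image.1 hw
      calc ∑ i, indVec P z θ' i ^ 2 ≤ ∑ _i : Fin N, (1 : ℝ) := by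
            refine Finset.sum_le_sum fun i _ => ?_
            simp only [indVec]
            split_ifs <;> norm_num
        _ = N := by simp
    · have h1 : (0 : ℝ) < (S.image (indVec P z)).card := by
        exact_mod_cast Finset.card_pos.2 ⟨_, Finset.mem_image_of_mem _ (hπS θ₀)⟩
      have h2 : ((S.image (indVec P z)).card : ℝ) ≤ k + 1 := by
        have := (Finset.card_image_le (s := S) (f := indVec P z)).trans hSk
        exact_mod_cast this.trans (Nat.le_succ k)
      have := Real.log_le_log h1 h2
      linarith
  have hfine : signAvg (fun σ => ∑ i, rsign (σ i) * rem (tr (θ σ)) i) ≤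
      Real.sqrt (2 * (1 / (V + 1) * N) * (L₀ + V * Real.log N)) := by
    refine massart_sqrt ((traces P z).image rem) _
      (fun σ => Finset.mem_image_of_mem _ (htr _)) ?_ ?_ (by positivity) (by positivity)
    · intro w hw
      obtain ⟨A, -, rfl⟩ := Finset.mem_image.1 hw
      -- The entries of a remainder are `0` or `±1`, so its squared length counts the disagreements.
      refine le_trans (le_of_eq ?_) (hπ (rep A))
      rw [disagree, Finset.card_filter]
      push_cast
      refine Finset.sum_congr rfl fun i _ => ?_
      simp only [rem, indVec]
      by_cases h1 : P (z i) (rep A) <;> by_cases h2 : P (z i) (π (rep A)) <;> simp [h1, h2]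
    · have h1 : (0 : ℝ) < ((traces P z).image rem).card := by
        exact_mod_cast Finset.card_pos.2 ⟨_, Finset.mem_image_of_mem _ (htr θ₀)⟩
      have h2 : (((traces P z).image rem).card : ℝ) ≤ (C + 1) * (2 * N) ^ V := by
        calc (((traces P z).image rem).card : ℝ) ≤ ((C * (N + 1) ^ V : ℕ) : ℝ) := by
              exact_mod_cast Finset.card_image_le.trans (h N z)
          _ ≤ (C + 1) * (2 * N) ^ V := by
              push_cast
              gcongr <;> linarith
      have h3 := Real.log_le_log h1 h2
      rw [Real.log_mul (by positivity) (by positivity), Real.log_pow,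
        Real.log_mul (by norm_num) (by positivity)] at h3
      linarith
  rw [hdecomp, signAvg_add, ← Real.sqrt_mul (by positivity)]
  refine (add_le_add hcoarse hfine).trans ?_
  refine Real.le_sqrt_of_sq_le ?_
  have h1 := Real.sq_sqrt (x := 2 * N * L₁) (by positivity)
  have h2 := Real.sq_sqrt (x := 2 * (1 / (V + 1) * N) * (L₀ + V * Real.log N)) (by positivity)
  have h3 : 2 * (1 / (V + 1) * N) * (L₀ + V * Real.log N) ≤ 2 * N * (L₀ + Real.log N) := by
    have h4 : 1 / ((V : ℝ) + 1) * (L₀ + V * Real.log N) ≤ L₀ + Real.log N := by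
      rw [one_div, inv_mul_le_iff₀ hV]
      nlinarith [mul_nonneg (Nat.cast_nonneg (α := ℝ) V) hL₀0.le]
    calc 2 * (1 / ((V : ℝ) + 1) * N) * (L₀ + V * Real.log N)
        = 2 * N * (1 / ((V : ℝ) + 1) * (L₀ + V * Real.log N)) := by ring
      _ ≤ 2 * N * (L₀ + Real.log N) := by gcongr
  -- By `(x + y)² ≤ 2x² + 2y²`, with squares at most `2 N L₁` and `2 N (L₀ + log N)`; hence the
  -- coefficients `4`.
  nlinarith [sq_nonneg (Real.sqrt (2 * N * L₁) -
    Real.sqrt (2 * (1 / (V + 1) * N) * (L₀ + V * Real.log N)))]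

end Chaining

/-! ### The network computes tame families -/

section Message

variable {Z Θ : Type*}

/-- Neighbourhoods of varying size become sequences of the fixed length `δ`, padded by repetition.
Repetitions are harmless because messages are summed over distinct values. The vertex `y` is a
default for empty `A`. -/
theorem exists_enum {V : Type*} [DecidableEq V] (A : Finset V) (y : V) {δ : ℕ}
    (hA : A.card ≤ δ) :
    ∃ w : Fin δ → V, A.Nonempty → Finset.univ.image w = A := by
  by_cases hne : A.Nonempty
  · obtain ⟨a, ha⟩ := hne
    refine ⟨fun i => if h : (i : ℕ) < A.card then (A.equivFin.symm ⟨i, h⟩ : V) else a,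
      fun _ => ?_⟩
    ext b
    simp only [Finset.mem_image, Finset.mem_univ, true_and]
    constructor
    · rintro ⟨i, rfl⟩
      split_ifs
      · exact Subtype.property _
      · exact ha
    · intro hb
      refine ⟨⟨A.equivFin ⟨b, hb⟩, (A.equivFin ⟨b, hb⟩).2.trans_le hA⟩, ?_⟩
      simp
  · exact ⟨fun _ => y, fun h => absurd h hne⟩

/-- A sum over the distinct values of a finite sequence. -/
theorem sum_image_eq_sum_first {δ : ℕ} {α M : Type*} [DecidableEq α] [AddCommMonoid M]
    (F : Fin δ → α) (g : α → M) [∀ i, Decidable (∃ j, j < i ∧ F j = F i)] :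
    ∑ p ∈ Finset.univ.image F, g p = ∑ i, if ∃ j, j < i ∧ F j = F i then 0 else g (F i) := by
  classical
  have himg : Finset.univ.image F =
      (Finset.univ.filter fun i => ¬ ∃ j, j < i ∧ F j = F i).image F := by
    ext p
    simp only [Finset.mem_image, Finset.mem_univ, true_and, Finset.mem_filter]
    constructor
    · rintro ⟨i, rfl⟩
      have hne : (Finset.univ.filter fun j => F j = F i).Nonempty := ⟨i, by simp⟩
      have hmem := Finset.min'_mem _ hne
      simp only [Finset.mem_filter, Finset.mem_univ, true_and] at hmem
      refine ⟨_, ?_, hmem⟩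
      rintro ⟨j, hj, hFj⟩
      exact absurd (Finset.min'_le _ j (by simp [hFj, hmem])) (not_le.2 hj)
    · rintro ⟨i, -, h⟩
      exact ⟨i, h⟩
  rw [himg, Finset.sum_image, Finset.sum_filter]
  · exact Finset.sum_congr rfl fun i _ => by split_ifs <;> simp_all
  · intro i hi j hj hij
    simp only [Finset.coe_filter, Finset.mem_univ, true_and, Set.mem_ofPred_eq] at hi hj
    rcases lt_trichotomy i j with h | h | h
    · exact absurd ⟨i, h, hij⟩ hj
    · exact h
    · exact absurd ⟨j, h, hij.symm⟩ hi

/-- The sum over a set becomes a sum over `δ` positions in which an entry counts only at its first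
occurrence. The test for an earlier occurrence compares tame families, so it has polynomial growth.
Quantifying over vertex choices `φ` in `hh` keeps the pieces uniform in `z`. -/
theorem tame_message {V : Z → Type*} {c δ : ℕ} (y : ∀ z, V z) (A : ∀ z, Finset (V z))
    (hA : ∀ z, (A z).card ≤ δ) (tag : ∀ z, V z → Bool) (h : ∀ z, Θ → V z → Emb c)
    (hh : ∀ (φ : ∀ z, V z) l, Tame fun z θ => h z θ (φ z) l)
    (W : Θ → Bool → Matrix (Fin c) (Fin c ⊕ Fin c) ℝ) (i : Fin c) :
    Tame fun z θ => message (W θ) (A z) (tag z) (h z θ) i := by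
  classical
  choose w hw using fun z => exists_enum (A z) (y z) (hA z)
  have heq : (fun z θ => message (W θ) (A z) (tag z) (h z θ) i) = fun z θ =>
      if (A z).Nonempty then
        ∑ a : Fin δ, if ∃ b, b < a ∧ tag z (w z b) = tag z (w z a) ∧
            ∀ l, h z θ (w z b) l = h z θ (w z a) l then 0
          else ∑ l, (if tag z (w z a) = true then W θ true i l else W θ false i l) *
            h z θ (w z a) l
      else 0 := by
    funext z θ
    split_ifs with hne
    · have h1 : (A z).image (fun v => (tag z v, h z θ v)) =
          Finset.univ.image fun a => (tag z (w z a), h z θ (w z a)) := by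
        conv_lhs => rw [← hw z hne, Finset.image_image]
        rfl
      have h2 : message (W θ) (A z) (tag z) (h z θ) =
          ∑ p ∈ (A z).image (fun v => (tag z v, h z θ v)), W θ p.1 *ᵥ p.2 := by
        unfold message
        congr!
      rw [h2, h1, sum_image_eq_sum_first, Finset.sum_apply]
      refine Finset.sum_congr rfl fun a _ => ?_
      simp only [Prod.mk.injEq, ← funext_iff]
      split_ifs with h3 h4
      · rfl
      · simp [Matrix.mulVec, dotProduct, h4]
      · simp [Matrix.mulVec, dotProduct, h4]
    · have : A z = ∅ := Finset.not_nonempty_iff_eq_empty.1 hne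
      simp [message, this]
  rw [heq]
  have hcoef : ∀ a l, Tame fun z θ =>
      if tag z (w z a) = true then W θ true i l else W θ false i l := fun a l => by
    convert Tame.ite (PolyGrowth.const fun z => tag z (w z a) = true)
      (Tame.param fun θ => W θ true i l) (Tame.param fun θ => W θ false i l)
  have hdup : ∀ a : Fin δ, PolyGrowth fun z θ => ∃ b, b < a ∧ tag z (w z b) = tag z (w z a) ∧
      ∀ l, h z θ (w z b) l = h z θ (w z a) l := fun a =>
    PolyGrowth.exists fun b => (PolyGrowth.const fun _ => b < a).and
      ((PolyGrowth.const fun z => tag z (w z b) = tag z (w z a)).and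
        (PolyGrowth.forall fun l =>
          (hh (fun z => w z b) l).polyGrowth_eq (hh (fun z => w z a) l)))
  convert Tame.ite (PolyGrowth.const fun z => (A z).Nonempty)
    (Tame.sum Finset.univ fun a => Tame.ite (hdup a) (Tame.index fun _ => (0 : ℝ))
      (Tame.sum Finset.univ fun l => (hcoef a l).mul (hh (fun z => w z a) l)))
    (Tame.index fun _ => (0 : ℝ))

end Message

section Embed

/-- A labelled graph of bounded degree with features, a centre, a vertex and an indicator. -/
structure RootedGraph (R : Type*) (c δ : ℕ) where
  Λ : Type
  feat : Λ → Emb c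
  G : LGraph Λ R
  deg : G.DegreeLE δ
  x : Fin G.n
  y : Fin G.n
  active : ℕ → Prop

variable {R : Type*} {m c δ : ℕ}

theorem LGraph.card_inNbrs_le {Λ : Type*} {G : LGraph Λ R} (hG : G.DegreeLE δ) (r : R)
    (v : Fin G.n) : (G.inNbrs r v).card ≤ δ := by
  refine (Finset.card_le_card fun w hw => ?_).trans (hG v)
  simp only [LGraph.inNbrs, LGraph.nbrs, Finset.mem_filter, Finset.mem_univ, true_and] at hw ⊢
  exact ⟨r, Or.inl hw⟩

theorem LGraph.card_outNbrs_le {Λ : Type*} {G : LGraph Λ R} (hG : G.DegreeLE δ) (r : R)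
    (v : Fin G.n) : (G.outNbrs r v).card ≤ δ := by
  refine (Finset.card_le_card fun w hw => ?_).trans (hG v)
  simp only [LGraph.outNbrs, LGraph.nbrs, Finset.mem_filter, Finset.mem_univ, true_and] at hw ⊢
  exact ⟨r, Or.inr hw⟩

theorem LGraph.DegreeLE.keepEdges {Λ : Type*} {G : LGraph Λ R} (hG : G.DegreeLE δ)
    (K : Set (Fin G.n × R × Fin G.n)) : (G.keepEdges K).DegreeLE δ := by
  intro v
  classical
  have hsub : (G.keepEdges K).nbrs v ⊆ G.nbrs v := by
    refine fun w hw => Finset.mem_filter.2 ⟨Finset.mem_univ _, ?_⟩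
    obtain ⟨r, h⟩ := (Finset.mem_filter.1 hw).2
    exact ⟨r, h.imp (fun h => (Finset.mem_filter.1 h).1) fun h => (Finset.mem_filter.1 h).1⟩
  exact (Finset.card_le_card hsub).trans (hG v)

theorem tame_mulVec {Z Θ : Type*} (W : Θ → Matrix (Fin c) (Fin c ⊕ Fin c) ℝ)
    {h : Z → Θ → Emb c} (hh : ∀ l, Tame fun z θ => h z θ l) (i : Fin c) :
    Tame fun z θ => (W θ *ᵥ h z θ) i :=
  Tame.sum Finset.univ fun l => (Tame.param fun θ => W θ i l).mul (hh l)

variable [Fintype R]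

theorem tame_embed (k : ℕ) (hk : k ≤ m) (j : Fin c ⊕ Fin c) :
    Tame fun (z : RootedGraph R c δ) (W : Weights R m c) =>
      embed W z.feat z.G z.x z.active k hk z.y j := by
  classical
  induction k generalizing j with
  | zero => exact Tame.index fun z : RootedGraph R c δ => z.feat (z.G.label z.y) j
  | succ k ih =>
    have hh : ∀ (φ : ∀ z : RootedGraph R c δ, Fin z.G.n) l,
        Tame fun (z : RootedGraph R c δ) (W : Weights R m c) =>
          embed W z.feat z.G z.x z.active k (Nat.le_of_succ_le hk) (φ z) l := fun φ l =>
      -- The observed vertex belongs to the point, so moving to a neighbour is a reindexing.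
      (ih (Nat.le_of_succ_le hk) l).comap fun z : RootedGraph R c δ => { z with y := φ z }
    have hmsg : ∀ (A : ∀ z : RootedGraph R c δ, R → Finset (Fin z.G.n)),
        (∀ z r, (A z r).card ≤ δ) → ∀ i,
        Tame fun (z : RootedGraph R c δ) (W : Weights R m c) =>
          (W.self *ᵥ embed W z.feat z.G z.x z.active k (Nat.le_of_succ_le hk) z.y +
            ∑ r, message (W.msg ⟨k, hk⟩ r) (A z r)
              (fun w => decide (w = z.x ∧ z.active (k + 1)))
              (embed W z.feat z.G z.x z.active k (Nat.le_of_succ_le hk))) i := by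
      intro A hA i
      simp only [Pi.add_apply, Finset.sum_apply]
      exact (tame_mulVec (fun W : Weights R m c => W.self) (hh fun z => z.y) i).add
        (Tame.sum Finset.univ fun r => tame_message (fun z : RootedGraph R c δ => z.y)
          (fun z => A z r) (fun z => hA z r) _ _ hh (fun W => W.msg ⟨k, hk⟩ r) i)
    rcases j with i | i
    · convert hmsg (fun z r => z.G.inNbrs r z.y) (fun z r => LGraph.card_inNbrs_le z.deg r _) i
        using 3
      simp only [embed, com, Sum.elim_inl]
    · convert hmsg (fun z r => z.G.outNbrs r z.y) (fun z r => LGraph.card_outNbrs_le z.deg r _) i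
        using 3
      simp only [embed, com, Sum.elim_inr]

end Embed

/-! ### The discrepancy of normalized embeddings -/

section Discrepancy

variable {c : ℕ}

theorem discrepancy_normalize_nonneg (a b : Emb c) :
    0 ≤ discrepancy (normalize a) (normalize b) :=
  Finset.sum_nonneg fun _ _ => sq_nonneg _

theorem normalize_nonneg (a : Emb c) (i : Fin c ⊕ Fin c) : 0 ≤ normalize a i :=
  div_nonneg (abs_nonneg _) (Real.sqrt_nonneg _)

theorem normalize_sq (a : Emb c) (i : Fin c ⊕ Fin c) :
    normalize a i ^ 2 = a i ^ 2 / ∑ j, a j ^ 2 := by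
  rw [normalize, l2norm, div_pow, sq_abs, Real.sq_sqrt (Finset.sum_nonneg fun _ _ => sq_nonneg _)]

/-- Normalized entries are nonnegative, so each positive part is at most the entry of the first
vector, which has norm `1` or `0`. -/
theorem discrepancy_normalize_le_one (a b : Emb c) :
    discrepancy (normalize a) (normalize b) ≤ 1 := by
  calc discrepancy (normalize a) (normalize b) ≤ ∑ i, normalize a i ^ 2 := by
        refine Finset.sum_le_sum fun i _ => pow_le_pow_left₀ (le_max_left _ _) ?_ 2
        have := normalize_nonneg b i
        exact max_le (normalize_nonneg a i) (by linarith)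
    _ = (∑ i, a i ^ 2) / ∑ j, a j ^ 2 := by
        rw [Finset.sum_div]
        exact Finset.sum_congr rfl fun i _ => normalize_sq a i
    _ ≤ 1 := div_self_le_one _

theorem discrepancy_normalize_of_left_eq_zero {a : Emb c} (b : Emb c) (ha : ∑ i, a i ^ 2 = 0) :
    discrepancy (normalize a) (normalize b) = 0 := by
  refine Finset.sum_eq_zero fun i _ => ?_
  have h1 : normalize a i = 0 := by simp [normalize, l2norm, ha]
  have h2 := normalize_nonneg b i
  rw [h1, max_eq_left (by linarith)]
  norm_num

theorem discrepancy_normalize_of_right_eq_zero {a b : Emb c} (ha : ∑ i, a i ^ 2 ≠ 0)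
    (hb : ∑ i, b i ^ 2 = 0) : discrepancy (normalize a) (normalize b) = 1 := by
  calc discrepancy (normalize a) (normalize b) = ∑ i, normalize a i ^ 2 := by
        refine Finset.sum_congr rfl fun i _ => ?_
        have h1 : normalize b i = 0 := by simp [normalize, l2norm, hb]
        rw [h1, sub_zero, max_eq_right (normalize_nonneg a i)]
    _ = (∑ i, a i ^ 2) / ∑ j, a j ^ 2 := by
        rw [Finset.sum_div]
        exact Finset.sum_congr rfl fun i _ => normalize_sq a i
    _ = 1 := div_self ha

open Classical in
/-- The indicator of the coordinates that contribute to the discrepancy. -/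
noncomputable def excess (a b : Emb c) (i : Fin c ⊕ Fin c) : ℝ :=
  if b i ^ 2 * ∑ j, a j ^ 2 < a i ^ 2 * ∑ j, b j ^ 2 then 1 else 0

/-- The part of `(discrepancy - t)` that is rational in the entries, cleared of denominators. -/
noncomputable def rationalPart (a b : Emb c) (t : ℝ) : ℝ :=
  (∑ i, excess a b i * a i ^ 2) * (∑ j, b j ^ 2) +
    (∑ i, excess a b i * b i ^ 2) * (∑ j, a j ^ 2) - t * (∑ j, a j ^ 2) * ∑ j, b j ^ 2

/-- The coefficient of the irrational part of the discrepancy. -/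
noncomputable def crossPart (a b : Emb c) : ℝ := ∑ i, excess a b i * (|a i| * |b i|)

theorem excess_nonneg (a b : Emb c) (i : Fin c ⊕ Fin c) : 0 ≤ excess a b i := by
  unfold excess
  split_ifs <;> norm_num

/-- Expanding the square on the contributing coordinates leaves the product of the two norms as the
only irrational quantity. Those coordinates are themselves selected by comparing squares, without
roots. -/
theorem discrepancy_normalize_mul {a b : Emb c} (ha : 0 < ∑ i, a i ^ 2)
    (hb : 0 < ∑ i, b i ^ 2) :
    discrepancy (normalize a) (normalize b) * ((∑ i, a i ^ 2) * ∑ i, b i ^ 2) =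
      (∑ i, excess a b i * a i ^ 2) * (∑ j, b j ^ 2) +
        (∑ i, excess a b i * b i ^ 2) * (∑ j, a j ^ 2) -
        2 * crossPart a b * (l2norm a * l2norm b) := by
  have hp : 0 < l2norm a := Real.sqrt_pos.2 ha
  have hq : 0 < l2norm b := Real.sqrt_pos.2 hb
  have hp2 : ∑ i, a i ^ 2 = l2norm a ^ 2 := (Real.sq_sqrt ha.le).symm
  have hq2 : ∑ i, b i ^ 2 = l2norm b ^ 2 := (Real.sq_sqrt hb.le).symm
  have hterm : ∀ i, max 0 (normalize a i - normalize b i) ^ 2 * (l2norm a ^ 2 * l2norm b ^ 2) =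
      excess a b i * a i ^ 2 * l2norm b ^ 2 + excess a b i * b i ^ 2 * l2norm a ^ 2 -
        2 * (excess a b i * (|a i| * |b i|)) * (l2norm a * l2norm b) := by
    intro i
    have hiff : b i ^ 2 * l2norm a ^ 2 < a i ^ 2 * l2norm b ^ 2 ↔
        normalize b i < normalize a i := by
      rw [← mul_pow, ← mul_pow, sq_lt_sq, abs_mul, abs_mul, abs_of_pos hp, abs_of_pos hq,
        normalize, normalize, div_lt_div_iff₀ hq hp]
    unfold excess
    rw [hp2, hq2]
    split_ifs with h
    · rw [max_eq_right (sub_nonneg.2 (hiff.1 h).le), ← sq_abs (a i), ← sq_abs (b i), normalize,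
        normalize]
      field_simp
      ring
    · rw [max_eq_left (sub_nonpos.2 (not_lt.1 fun h' => h (hiff.2 h')))]
      ring
  rw [discrepancy, hp2, hq2, crossPart, Finset.sum_mul, Finset.sum_congr rfl fun i _ => hterm i,
    Finset.sum_sub_distrib, Finset.sum_add_distrib, Finset.sum_mul, Finset.sum_mul,
    Finset.mul_sum, Finset.sum_mul]

/-- The term with the root is isolated on one side; it is nonnegative, so squaring is an equivalence
once the other side is positive. -/
theorem lt_discrepancy_normalize_iff {a b : Emb c} (ha : 0 < ∑ i, a i ^ 2)
    (hb : 0 < ∑ i, b i ^ 2) (t : ℝ) :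
    t < discrepancy (normalize a) (normalize b) ↔
      0 < rationalPart a b t ∧
        4 * crossPart a b ^ 2 * ((∑ i, a i ^ 2) * ∑ i, b i ^ 2) < rationalPart a b t ^ 2 := by
  have hS : 0 ≤ crossPart a b := Finset.sum_nonneg fun i _ =>
    mul_nonneg (excess_nonneg a b i) (mul_nonneg (abs_nonneg _) (abs_nonneg _))
  have hnn : 0 ≤ 2 * crossPart a b * (l2norm a * l2norm b) :=
    mul_nonneg (mul_nonneg zero_le_two hS) (mul_nonneg (Real.sqrt_nonneg _) (Real.sqrt_nonneg _))
  have hsq : 4 * crossPart a b ^ 2 * ((∑ i, a i ^ 2) * ∑ i, b i ^ 2) =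
      (2 * crossPart a b * (l2norm a * l2norm b)) ^ 2 := by
    have h1 : l2norm a ^ 2 = ∑ i, a i ^ 2 := Real.sq_sqrt ha.le
    have h2 : l2norm b ^ 2 = ∑ i, b i ^ 2 := Real.sq_sqrt hb.le
    rw [← h1, ← h2]
    ring
  have h1 : t < discrepancy (normalize a) (normalize b) ↔
      2 * crossPart a b * (l2norm a * l2norm b) < rationalPart a b t := by
    rw [← mul_lt_mul_iff_left₀ (mul_pos ha hb), discrepancy_normalize_mul ha hb, rationalPart]
    constructor <;> intro h <;> linarith
  rw [h1, hsq]
  constructor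
  · intro h
    exact ⟨hnn.trans_lt h, pow_lt_pow_left₀ h hnn two_ne_zero⟩
  · rintro ⟨h, h'⟩
    exact lt_of_pow_lt_pow_left₀ 2 h.le h'

theorem polyGrowth_discrepancy {Z Θ : Type*} {a b : Z → Θ → Emb c}
    (ha : ∀ i, Tame fun z θ => a z θ i) (hb : ∀ i, Tame fun z θ => b z θ i) (t : Z → ℝ) :
    PolyGrowth fun z θ => t z < discrepancy (normalize (a z θ)) (normalize (b z θ)) := by
  classical
  have hp : Tame fun z θ => ∑ i, a z θ i ^ 2 := Tame.sum _ fun i => (ha i).sq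
  have hq : Tame fun z θ => ∑ i, b z θ i ^ 2 := Tame.sum _ fun i => (hb i).sq
  have he : ∀ i, Tame fun z θ => excess (a z θ) (b z θ) i := fun i =>
    Tame.ite (((hb i).sq.mul hp).polyGrowth_lt ((ha i).sq.mul hq)) (Tame.index fun _ => 1)
      (Tame.index fun _ => 0)
  have hX : Tame fun z θ => rationalPart (a z θ) (b z θ) (t z) :=
    (((Tame.sum _ fun i => (he i).mul (ha i).sq).mul hq).add
      ((Tame.sum _ fun i => (he i).mul (hb i).sq).mul hp)).sub
      (((Tame.index t).mul hp).mul hq)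
  have hS : Tame fun z θ => crossPart (a z θ) (b z θ) :=
    Tame.sum _ fun i => (he i).mul ((ha i).abs.mul (hb i).abs)
  have h0 : PolyGrowth fun z θ => ∑ i, a z θ i ^ 2 = 0 := hp.polyGrowth_eq (Tame.index fun _ => 0)
  have h0' : PolyGrowth fun z θ => ∑ i, b z θ i ^ 2 = 0 :=
    hq.polyGrowth_eq (Tame.index fun _ => 0)
  -- The cases are a vanishing first vector (discrepancy `0`), only the second vanishing
  -- (discrepancy `1`), and neither vanishing, where the root-free criterion applies.
  refine ((h0.and (PolyGrowth.const fun z => t z < 0)).or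
    (((h0.not.and h0').and (PolyGrowth.const fun z => t z < 1)).or
      ((h0.not.and h0'.not).and (hX.polyGrowth_pos.and
        ((((Tame.index fun _ => 4).mul hS.sq).mul (hp.mul hq)).polyGrowth_lt hX.sq))))).of_iff ?_
  intro z θ
  have hnn : ∀ x : Emb c, 0 ≤ ∑ i, x i ^ 2 := fun x => Finset.sum_nonneg fun _ _ => sq_nonneg _
  by_cases h1 : ∑ i, a z θ i ^ 2 = 0
  · rw [discrepancy_normalize_of_left_eq_zero _ h1]
    simp only [h1, true_and, not_true_eq_false, false_and, or_false]
  by_cases h2 : ∑ i, b z θ i ^ 2 = 0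
  · rw [discrepancy_normalize_of_right_eq_zero h1 h2]
    simp only [h1, h2, true_and, not_true_eq_false, not_false_eq_true, and_false, false_and,
      or_false, false_or]
  rw [lt_discrepancy_normalize_iff ((hnn _).lt_of_ne' h1) ((hnn _).lt_of_ne' h2)]
  simp only [h1, h2, true_and, not_false_eq_true, and_false, false_and, false_or]

end Discrepancy

/-! ### The loss -/

section Loss

variable {R : Type*} {m c δ : ℕ}

/-- A training example of bounded degree, with features, a filtering stage and a threshold. -/
structure Instance (R : Type*) (c δ : ℕ) where
  Λ : Type
  feat : Λ → Emb c
  prune : Pruning Λ R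
  s : Sample Λ R
  degQ : s.Q.DegreeLE δ
  degG : s.G.DegreeLE δ
  t : ℝ

variable [Fintype R]

/-- The discrepancy of the two embeddings computed by the network. -/
noncomputable def netDisc {Λ : Type*} (W : Weights R m c) (feat : Λ → Emb c) (prune : Pruning Λ R)
    (s : Sample Λ R) : ℝ :=
  discrepancy (patternEmb W feat s.Q s.u)
    (dataEmb W feat s.Q s.u (s.G.keepEdges (prune s)) s.v)

theorem netDisc_nonneg {Λ : Type*} (W : Weights R m c) (feat : Λ → Emb c) (prune : Pruning Λ R)
    (s : Sample Λ R) : 0 ≤ netDisc W feat prune s :=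
  discrepancy_normalize_nonneg _ _

theorem netDisc_le_one {Λ : Type*} (W : Weights R m c) (feat : Λ → Emb c) (prune : Pruning Λ R)
    (s : Sample Λ R) : netDisc W feat prune s ≤ 1 :=
  discrepancy_normalize_le_one _ _

/-- Filtering, ego networks and the cycle indicator depend on the example and not on the weights, so
all of them can be moved into the point. -/
theorem polyGrowth_netDisc :
    PolyGrowth fun (z : Instance R c δ) (W : Weights R m c) =>
      z.t < netDisc W z.feat z.prune z.s :=
  polyGrowth_discrepancy
    (fun i => (tame_embed m le_rfl i).comap fun z : Instance R c δ =>
      { Λ := z.Λ, feat := z.feat, G := z.s.Q.ego z.s.u m, deg := z.degQ.keepEdges _, x := z.s.u,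
        y := z.s.u, active := fun _ => True : RootedGraph R c δ })
    (fun i => (tame_embed m le_rfl i).comap fun z : Instance R c δ =>
      { Λ := z.Λ, feat := z.feat, G := (z.s.G.keepEdges (z.prune z.s)).ego z.s.v m,
        deg := (z.degG.keepEdges _).keepEdges _, x := z.s.v, y := z.s.v,
        active := fun k => z.s.Q.OnCycle z.s.u k : RootedGraph R c δ })
    fun z => z.t

/-- The strict superlevel sets of the discrepancy on the instances with second component `True`,
and its weak sublevel sets on the others. -/
theorem polyGrowth_level :
    PolyGrowth fun (z : Instance R c δ × Prop) (W : Weights R m c) =>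
      z.2 ↔ z.1.t < netDisc W z.1.feat z.1.prune z.1.s := by
  have h := (polyGrowth_netDisc (m := m)).comap
    (Prod.fst : Instance R c δ × Prop → Instance R c δ)
  refine (((PolyGrowth.const fun z : Instance R c δ × Prop => z.2).and h).or
    ((PolyGrowth.const fun z : Instance R c δ × Prop => ¬ z.2).and h.not)).of_iff fun z W => ?_
  tauto

open Classical in
/-- The least possible loss on an example. -/
noncomputable def baseLoss {Λ : Type*} (α : ℝ) (s : Sample Λ R) : ℝ :=
  if s.IsPositive then -α else max 0 (α - 1)

open Classical in
/-- The threshold for the discrepancy at which the loss exceeds its least value by `x`. -/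
noncomputable def levelThreshold {Λ : Type*} (α : ℝ) (s : Sample Λ R) (x : ℝ) : ℝ :=
  if s.IsPositive then x else α - baseLoss α s - x

/-- The discrepancy lies in the unit interval, so the loss varies by at most one whatever the
margin. -/
theorem loss_sub_baseLoss_mem {Λ : Type*} (W : Weights R m c) (feat : Λ → Emb c)
    (prune : Pruning Λ R) (α : ℝ) (s : Sample Λ R) :
    0 ≤ loss W feat prune α s - baseLoss α s ∧ loss W feat prune α s - baseLoss α s ≤ 1 := by
  have h0 := netDisc_nonneg W feat prune s
  have h1 := netDisc_le_one W feat prune s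
  simp only [loss, baseLoss]
  rw [← netDisc]
  split_ifs
  · constructor <;> linarith
  · rcases max_cases 0 (α - netDisc W feat prune s) with h | h <;>
      rcases max_cases 0 (α - 1) with h' | h' <;> constructor <;> linarith

/-- For a negative example, exceeding the nonnegative base value by `x > 0` forces the hinge to be
active. Together with `le_of_level` this sandwiches the predicate between strict and weak excess, as
`abs_sub_levels_le` requires. -/
theorem level_of_lt {Λ : Type*} (W : Weights R m c) (feat : Λ → Emb c)
    (prune : Pruning Λ R) (α : ℝ) (s : Sample Λ R) {x : ℝ}
    (h : x < loss W feat prune α s - baseLoss α s) (hx : 0 < x) :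
    s.IsPositive ↔ levelThreshold α s x < netDisc W feat prune s := by
  simp only [loss] at h
  rw [← netDisc] at h
  by_cases hs : s.IsPositive
  · simp only [levelThreshold, baseLoss, hs, if_true, true_iff] at h ⊢
    linarith
  · simp only [levelThreshold, baseLoss, hs, if_false, false_iff, not_lt] at h ⊢
    rcases max_cases 0 (α - netDisc W feat prune s) with h1 | h1 <;>
      rcases max_cases 0 (α - 1) with h2 | h2 <;> linarith

theorem le_of_level {Λ : Type*} (W : Weights R m c) (feat : Λ → Emb c)
    (prune : Pruning Λ R) (α : ℝ) (s : Sample Λ R) {x : ℝ}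
    (h : s.IsPositive ↔ levelThreshold α s x < netDisc W feat prune s) :
    x ≤ loss W feat prune α s - baseLoss α s := by
  simp only [loss]
  rw [← netDisc]
  by_cases hs : s.IsPositive
  · simp only [levelThreshold, baseLoss, hs, if_true, true_iff] at h ⊢
    linarith
  · simp only [levelThreshold, baseLoss, hs, if_false, false_iff, not_lt] at h ⊢
    have := le_max_right 0 (α - netDisc W feat prune s)
    linarith

theorem abs_loss_le {Λ : Type*} (W : Weights R m c) (feat : Λ → Emb c)
    (prune : Pruning Λ R) (α : ℝ) (s : Sample Λ R) :
    |loss W feat prune α s| ≤ 1 + |baseLoss α s| := by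
  have h := loss_sub_baseLoss_mem W feat prune α s
  calc |loss W feat prune α s|
      = |(loss W feat prune α s - baseLoss α s) + baseLoss α s| := by rw [sub_add_cancel]
    _ ≤ |loss W feat prune α s - baseLoss α s| + |baseLoss α s| := abs_add_le _ _
    _ ≤ 1 + |baseLoss α s| := by
        rw [abs_of_nonneg h.1]
        linarith

end Loss

/-! ### From levels to real-valued functions -/

section Levels

open Classical in
/-- A number in the unit interval is, up to `1 / N`, the proportion of the levels `j / N` that
it exceeds. -/
theorem abs_sub_levels_le {N : ℕ} (hN : 0 < N) {g : ℝ} (h0 : 0 ≤ g) (h1 : g ≤ 1)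
    {q : ℕ → Prop} (hq : ∀ j, ((j + 1 : ℕ) : ℝ) / N < g → q j)
    (hq' : ∀ j, q j → ((j + 1 : ℕ) : ℝ) / N ≤ g) :
    |g - (N : ℝ)⁻¹ * ∑ j ∈ Finset.range N, (if q j then (1 : ℝ) else 0)| ≤ (N : ℝ)⁻¹ := by
  have hN' : (0 : ℝ) < N := by exact_mod_cast hN
  have hsum : ∑ j ∈ Finset.range N, (if q j then (1 : ℝ) else 0) =
      ((Finset.range N).filter q).card := by
    simp
  set k := ((Finset.range N).filter q).card
  have hup : (k : ℝ) ≤ N * g := by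
    have hsub : (Finset.range N).filter q ⊆ Finset.range ⌊N * g⌋₊ := by
      intro j hj
      have := hq' j (Finset.mem_filter.1 hj).2
      rw [div_le_iff₀ hN', mul_comm] at this
      exact Finset.mem_range.2 (Nat.le_floor this)
    have := Finset.card_le_card hsub
    rw [Finset.card_range] at this
    exact (Nat.cast_le.2 this).trans (Nat.floor_le (by positivity))
  have hlow : N * g - 1 ≤ k := by
    -- The levels strictly below `g` are those with `j + 1 < ⌈N g⌉`; all of them are counted, at a
    -- loss of at most one.
    have hsub : Finset.range (⌈N * g⌉₊ - 1) ⊆ (Finset.range N).filter q := by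
      intro j hj
      have hj1 : j + 1 < ⌈N * g⌉₊ := by
        have := Finset.mem_range.1 hj
        omega
      have hj2 : ((j + 1 : ℕ) : ℝ) < N * g := Nat.lt_ceil.1 hj1
      refine Finset.mem_filter.2 ⟨Finset.mem_range.2 ?_, hq j ?_⟩
      · have : ((j + 1 : ℕ) : ℝ) < N := hj2.trans_le (by nlinarith)
        have := Nat.cast_lt.1 this
        omega
      · rwa [div_lt_iff₀ hN', mul_comm]
    have h2 := Finset.card_le_card hsub
    rw [Finset.card_range] at h2
    have h3 : (⌈N * g⌉₊ : ℝ) ≤ k + 1 := by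
      have : ⌈N * g⌉₊ ≤ k + 1 := by omega
      exact_mod_cast this
    linarith [Nat.le_ceil (N * g)]
  rw [hsum, abs_le]
  have hNi : (0 : ℝ) < (N : ℝ)⁻¹ := inv_pos.2 hN'
  have e : (N : ℝ)⁻¹ * (N * g) = g := by field_simp
  have u := mul_le_mul_of_nonneg_left hup hNi.le
  have l := mul_le_mul_of_nonneg_left hlow hNi.le
  rw [e] at u
  rw [mul_sub, e, mul_one] at l
  constructor <;> linarith

theorem abs_rsign (b : Bool) : |rsign b| = 1 := by
  cases b <;> simp [rsign]

/-- Flipping all signs negates the sum. Base losses therefore contribute nothing, and the bounds do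
not depend on the margin. -/
theorem signAvg_fixed {N : ℕ} (a : Fin N → ℝ) :
    signAvg (fun σ => ∑ i, rsign (σ i) * a i) = 0 := by
  have hflip : signAvg (fun σ : Fin N → Bool => ∑ i, rsign (σ i) * a i) =
      signAvg (fun σ => -∑ i, rsign (σ i) * a i) := by
    unfold signAvg
    congr 1
    refine Fintype.sum_equiv (Equiv.arrowCongr (Equiv.refl _) Equiv.boolNot) _ _ fun σ => ?_
    rw [← Finset.sum_neg_distrib]
    refine Finset.sum_congr rfl fun i _ => ?_
    cases h : σ i <;> simp [h, rsign]
  have hneg : signAvg (fun σ : Fin N → Bool => -∑ i, rsign (σ i) * a i) =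
      -signAvg (fun σ => ∑ i, rsign (σ i) * a i) := by
    simp [signAvg]
  linarith

/-- To bound the Rademacher complexity, it suffices to bound the averages along all selections
of functions from the class. -/
theorem empiricalRademacher_le {X : Type*} {N : ℕ} (hN : 0 < N) {F : Set (X → ℝ)}
    (hF : F.Nonempty) (x : Fin N → X) {B : ℝ}
    (h : ∀ f : (Fin N → Bool) → X → ℝ, (∀ σ, f σ ∈ F) →
      signAvg (fun σ => ∑ i, rsign (σ i) * f σ (x i)) ≤ B) :
    empiricalRademacher F x ≤ (N : ℝ)⁻¹ * (B + 1) := by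
  have hNi : (0 : ℝ) < (N : ℝ)⁻¹ := inv_pos.2 (by exact_mod_cast hN)
  have : Nonempty F := hF.to_subtype
  have hsel : ∀ σ : Fin N → Bool, ∃ f ∈ F,
      (⨆ f : F, (N : ℝ)⁻¹ * ∑ i, rsign (σ i) * f.1 (x i)) ≤
        (N : ℝ)⁻¹ * ((∑ i, rsign (σ i) * f (x i)) + 1) := by
    intro σ
    -- A function within `1/N` of the supremum replaces a maximizer and accounts for the `+ 1`.
    obtain ⟨f, hf⟩ := exists_lt_of_lt_ciSup (sub_lt_self
      (⨆ f : F, (N : ℝ)⁻¹ * ∑ i, rsign (σ i) * f.1 (x i)) hNi)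
    exact ⟨f.1, f.2, by linarith⟩
  choose f hfF hf using hsel
  calc empiricalRademacher F x
      = signAvg (fun σ => ⨆ f : F, (N : ℝ)⁻¹ * ∑ i, rsign (σ i) * f.1 (x i)) := rfl
    _ ≤ signAvg (fun σ => (N : ℝ)⁻¹ * ((∑ i, rsign (σ i) * f σ (x i)) + 1)) := signAvg_mono hf
    _ = (N : ℝ)⁻¹ * (signAvg (fun σ => ∑ i, rsign (σ i) * f σ (x i)) + 1) := by
        rw [signAvg_const_mul, signAvg_add, signAvg_const]
    _ ≤ (N : ℝ)⁻¹ * (B + 1) := by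
        have := h f hfF
        gcongr

end Levels

/-! ### Rademacher averages of the losses, and the degenerate scales. -/

section Complexity

variable {R : Type*} {m c δ : ℕ}

theorem Weights.bounded_zero {B₁ B₂ : ℝ} (hB₁ : 0 ≤ B₁) (hB₂ : 0 ≤ B₂) :
    (⟨0, 0⟩ : Weights R m c).Bounded B₁ B₂ :=
  ⟨by simpa using hB₁, fun _ _ _ => by simpa using hB₂⟩

variable [Fintype R]

theorem lossClass_nonempty {Λ : Type*} {B₁ B₂ : ℝ} (hB₁ : 0 ≤ B₁) (hB₂ : 0 ≤ B₂)
    (feat : Λ → Emb c) (prune : Pruning Λ R) (α : ℝ) :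
    (lossClass m c B₁ B₂ feat prune α).Nonempty :=
  ⟨_, _, Weights.bounded_zero hB₁ hB₂, rfl⟩

/-- The Rademacher averages of the losses, for all filtering stages, features and margins. -/
theorem exists_rademacher_loss (R : Type*) [Fintype R] (m c δ : ℕ) :
    ∃ K : ℝ, 0 ≤ K ∧ ∀ (Λ : Type) (feat : Λ → Emb c) (prune : Pruning Λ R) (α : ℝ)
      (N : ℕ) (sample : Fin N → Sample Λ R), 0 < N →
      (∀ i, (sample i).Q.DegreeLE δ ∧ (sample i).G.DegreeLE δ) →
      ∀ W : (Fin N → Bool) → Weights R m c,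
        signAvg (fun σ => ∑ i, rsign (σ i) * loss (W σ) feat prune α (sample i)) ≤
          1 + Real.sqrt N * Real.sqrt (K + 4 * Real.log N) := by
  classical
  obtain ⟨K, hK, h⟩ := (polyGrowth_level (R := R) (m := m) (c := c) (δ := δ)).rademacher
  refine ⟨K, hK, fun Λ feat prune α N sample hN hdeg W => ?_⟩
  have hN' : (0 : ℝ) < N := by exact_mod_cast hN
  -- Each level, with its threshold for each example, gives one sequence of points; a single `K`
  -- serves all levels.
  let z : ℕ → Fin N → Instance R c δ × Prop := fun j i =>
    (⟨Λ, feat, prune, sample i, (hdeg i).1, (hdeg i).2,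
      levelThreshold α (sample i) (((j + 1 : ℕ) : ℝ) / N)⟩, (sample i).IsPositive)
  let P : Instance R c δ × Prop → Weights R m c → Prop := fun z W =>
    z.2 ↔ z.1.t < netDisc W z.1.feat z.1.prune z.1.s
  -- The loss is its base value plus the average of its level indicators, up to `1/N` per example;
  -- the rounding adds up to `1` over the sample.
  have hpt : ∀ σ, ∑ i, rsign (σ i) * loss (W σ) feat prune α (sample i) ≤
      (∑ i, rsign (σ i) * baseLoss α (sample i)) + (1 + (N : ℝ)⁻¹ *
        ∑ j ∈ Finset.range N, ∑ i, rsign (σ i) * indVec P (z j) (W σ) i) := by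
    intro σ
    have hi : ∀ i, rsign (σ i) * loss (W σ) feat prune α (sample i) ≤
        rsign (σ i) * baseLoss α (sample i) + ((N : ℝ)⁻¹ + (N : ℝ)⁻¹ *
          ∑ j ∈ Finset.range N, rsign (σ i) * indVec P (z j) (W σ) i) := by
      intro i
      have hg := loss_sub_baseLoss_mem (W σ) feat prune α (sample i)
      have hlev := abs_sub_levels_le hN hg.1 hg.2 (q := fun j => P (z j i) (W σ))
        (fun j hj => level_of_lt (W σ) feat prune α (sample i) hj (by positivity))
        (fun j hj => le_of_level (W σ) feat prune α (sample i) hj)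
      have hind : ∀ j, indVec P (z j) (W σ) i =
          @ite ℝ (P (z j i) (W σ)) (Classical.propDecidable _) 1 0 := fun _ => rfl
      simp only [← hind] at hlev
      have habs := le_abs_self (rsign (σ i) * (loss (W σ) feat prune α (sample i) -
        baseLoss α (sample i) -
          (N : ℝ)⁻¹ * ∑ j ∈ Finset.range N, indVec P (z j) (W σ) i))
      rw [abs_mul, abs_rsign, one_mul] at habs
      have hle := habs.trans hlev
      rw [← Finset.mul_sum]
      linarith
    calc ∑ i, rsign (σ i) * loss (W σ) feat prune α (sample i)
        ≤ ∑ i, (rsign (σ i) * baseLoss α (sample i) + ((N : ℝ)⁻¹ + (N : ℝ)⁻¹ *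
          ∑ j ∈ Finset.range N, rsign (σ i) * indVec P (z j) (W σ) i)) :=
          Finset.sum_le_sum fun i _ => hi i
      _ = _ := by
          rw [Finset.sum_add_distrib, Finset.sum_add_distrib, ← Finset.mul_sum, Finset.sum_comm]
          simp [hN'.ne']
  refine (signAvg_mono hpt).trans ?_
  rw [signAvg_add, signAvg_fixed, zero_add, signAvg_add, signAvg_const, signAvg_const_mul,
    signAvg_sum]
  have hsum : ∑ j ∈ Finset.range N,
      signAvg (fun σ => ∑ i, rsign (σ i) * indVec P (z j) (W σ) i) ≤
      N * (Real.sqrt N * Real.sqrt (K + 4 * Real.log N)) := by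
    refine (Finset.sum_le_sum fun j _ => h N hN (z j) W).trans (le_of_eq ?_)
    simp
  have := mul_le_mul_of_nonneg_left hsum (inv_pos.2 hN').le
  rw [inv_mul_cancel_left₀ hN'.ne'] at this
  linarith

theorem feat_eq_zero {Λ : Type*} {feat : Λ → Emb c} (h : ∀ a, l2norm (feat a) ≤ 0) (a : Λ) :
    feat a = 0 := by
  have h1 : ∑ i, feat a i ^ 2 = 0 :=
    le_antisymm (Real.sqrt_eq_zero'.1 (le_antisymm (h a) (Real.sqrt_nonneg _)))
      (Finset.sum_nonneg fun _ _ => sq_nonneg _)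
  have h2 := (Finset.sum_eq_zero_iff_of_nonneg fun i _ => sq_nonneg (feat a i)).1 h1
  funext i
  simpa using h2 i (Finset.mem_univ i)

theorem embed_eq_zero {Λ : Type*} (W : Weights R m c) {feat : Λ → Emb c} (hf : ∀ a, feat a = 0)
    (G : LGraph Λ R) (x : Fin G.n) (active : ℕ → Prop) (k : ℕ) (hk : k ≤ m) :
    embed W feat G x active k hk = 0 := by
  induction k with
  | zero =>
    funext y
    exact hf _
  | succ k ih =>
    have hmsg : ∀ (M : Bool → Matrix (Fin c) (Fin c ⊕ Fin c) ℝ) (A : Finset (Fin G.n)) tag,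
        message M A tag (0 : Fin G.n → Emb c) = 0 := by
      intro M A tag
      refine Finset.sum_eq_zero fun p hp => ?_
      obtain ⟨w, -, rfl⟩ := Finset.mem_image.1 hp
      exact Matrix.mulVec_zero _
    funext y
    simp only [embed, ih (Nat.le_of_succ_le hk), hmsg]
    funext j
    rcases j with j | j <;> simp [com]

/-- If the scale of the network degenerates, then the loss does not depend on the weights. -/
theorem loss_eq_of_degenerate {Λ : Type*} {B₁ B₂ Bx : ℝ} {feat : Λ → Emb c}
    (hfeat : ∀ a, l2norm (feat a) ≤ Bx)
    (h : c = 0 ∨ B₂ = 0 ∧ (Bx = 0 ∨ B₁ = 0)) {W W' : Weights R m c}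
    (hW : W.Bounded B₁ B₂) (hW' : W'.Bounded B₁ B₂) (prune : Pruning Λ R) (α : ℝ) :
    loss W feat prune α = loss W' feat prune α := by
  rcases h with rfl | ⟨hB₂, rfl | hB₁⟩
  · have : W = W' := by
      obtain ⟨s, g⟩ := W
      obtain ⟨s', g'⟩ := W'
      congr 1
      · ext i
        exact i.elim0
      · funext _ _ _
        ext i
        exact i.elim0
    rw [this]
  · have h0 := feat_eq_zero hfeat
    funext s
    have hQ : ∀ U : Weights R m c, patternEmb U feat s.Q s.u = normalize 0 := fun U =>
      congrArg normalize (congrFun (embed_eq_zero U h0 (s.Q.ego s.u m) s.u _ m le_rfl) s.u)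
    have hG : ∀ U : Weights R m c,
        dataEmb U feat s.Q s.u (s.G.keepEdges (prune s)) s.v = normalize 0 := fun U =>
      congrArg normalize
        (congrFun (embed_eq_zero U h0 ((s.G.keepEdges (prune s)).ego s.v m) s.v _ m le_rfl) s.v)
    simp only [loss, hQ, hG]
  · have hzero : ∀ U : Weights R m c, U.Bounded B₁ B₂ → U = ⟨0, fun _ _ _ => 0⟩ := by
      rintro ⟨s, g⟩ ⟨h1, h2⟩
      congr 1
      · exact norm_le_zero_iff.1 (hB₁ ▸ h1)
      · funext k r b
        exact norm_le_zero_iff.1 (hB₂ ▸ h2 k r b)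
    rw [hzero W hW, hzero W' hW']

end Complexity

end HFrame

/-! ### The main theorem: calibration of the constants. -/

theorem theorem4 {R : Type*} [Fintype R] [Nonempty R] (m c δ : ℕ) (B₁ B₂ Bx : ℝ)
    (hB₁ : 0 ≤ B₁) (hB₂ : 0 ≤ B₂) (hBx : 0 ≤ Bx) :
    ∃ M ℛ : ℝ, 0 < M ∧ 0 < ℛ ∧
      ∀ (Λ : Type) (feat : Λ → HFrame.Emb c) (prune : HFrame.Pruning Λ R) (α : ℝ)
        (N : ℕ) (sample : Fin N → HFrame.Sample Λ R),
        0 < N →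
        (∀ a, HFrame.l2norm (feat a) ≤ Bx) →
        (∀ i, (sample i).Q.DegreeLE δ ∧ (sample i).G.DegreeLE δ) →
        (∀ i, ∃ C : ℝ, ∀ f ∈ HFrame.lossClass m c B₁ B₂ feat prune α, |f (sample i)| ≤ C) ∧
        HFrame.empiricalRademacher (HFrame.lossClass m c B₁ B₂ feat prune α) sample ≤
          8 / (N : ℝ) + 12 / Real.sqrt N *
            Real.sqrt (2 * (Fintype.card R : ℝ) * ((2 * c : ℕ) : ℝ) ^ 2 *
              Real.log (16 * M * Real.sqrt ((N : ℝ) * ((2 * c : ℕ) : ℝ)) *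
                max (Bx * B₁) (ℛ * B₂))) := by
  have hbdd : ∀ (Λ : Type) (feat : Λ → HFrame.Emb c) (prune : HFrame.Pruning Λ R) (α : ℝ)
      (s : HFrame.Sample Λ R),
      ∃ C : ℝ, ∀ f ∈ HFrame.lossClass m c B₁ B₂ feat prune α, |f s| ≤ C := by
    intro Λ feat prune α s
    refine ⟨1 + |HFrame.baseLoss α s|, ?_⟩
    rintro f ⟨W, -, rfl⟩
    exact HFrame.abs_loss_le W feat prune α s
  -- These are the cases in which `T = 0` for every choice of `M` and `ℛ`, so that only `8/N` is
  -- available.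
  by_cases hdeg : c = 0 ∨ B₂ = 0 ∧ (Bx = 0 ∨ B₁ = 0)
  · refine ⟨1, 1, one_pos, one_pos, fun Λ feat prune α N sample hN hfeat _ =>
      ⟨fun i => hbdd Λ feat prune α (sample i), ?_⟩⟩
    have hN' : (0 : ℝ) < N := by exact_mod_cast hN
    have hnn : 0 ≤ 12 / Real.sqrt N *
            Real.sqrt (2 * (Fintype.card R : ℝ) * ((2 * c : ℕ) : ℝ) ^ 2 *
              Real.log (16 * 1 * Real.sqrt ((N : ℝ) * ((2 * c : ℕ) : ℝ)) *
                max (Bx * B₁) (1 * B₂))) := by positivity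
    refine le_trans ?_ (le_add_of_nonneg_right hnn)
    refine (HFrame.empiricalRademacher_le hN
      (HFrame.lossClass_nonempty hB₁ hB₂ feat prune α) sample (B := 0) ?_).trans ?_
    · intro f hf
      have hconst : ∀ σ, f σ = f fun _ => true := by
        intro σ
        obtain ⟨W, hW, h⟩ := hf σ
        obtain ⟨W', hW', h'⟩ := hf fun _ => true
        rw [h, h', HFrame.loss_eq_of_degenerate hfeat hdeg hW hW']
      simp only [hconst]
      rw [HFrame.signAvg_fixed]
    · rw [zero_add, mul_one, inv_eq_one_div]
      gcongr
      norm_num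
  · push Not at hdeg
    obtain ⟨hc, hB⟩ := hdeg
    obtain ⟨K, hK, hrad⟩ := HFrame.exists_rademacher_loss R m c δ
    set μ : ℝ := max (Bx * B₁) (1 * B₂) with hμ
    have hμ0 : 0 < μ := by
      by_cases h2 : B₂ = 0
      · obtain ⟨h3, h4⟩ := hB h2
        exact lt_max_of_lt_left (mul_pos (hBx.lt_of_ne' h3) (hB₁.lt_of_ne' h4))
      · exact lt_max_of_lt_right (by rw [one_mul]; exact hB₂.lt_of_ne' h2)
    set d : ℝ := ((2 * c : ℕ) : ℝ) with hd
    have hd2 : 2 ≤ d := by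
      rw [hd]
      exact_mod_cast (by omega : 2 ≤ 2 * c)
    have hsd : 0 < Real.sqrt d := Real.sqrt_pos.2 (by linarith)
    -- This `M` makes `T = exp K · √N`, hence `log T = K + (log N)/2`.
    refine ⟨Real.exp K / (16 * Real.sqrt d * μ), 1, by positivity, one_pos,
      fun Λ feat prune α N sample hN _ hdeg =>
        ⟨fun i => hbdd Λ feat prune α (sample i), ?_⟩⟩
    rw [← hμ]
    have hN1 : (1 : ℝ) ≤ N := by exact_mod_cast hN
    have hN' : (0 : ℝ) < N := by linarith
    have hsN : 0 < Real.sqrt N := Real.sqrt_pos.2 hN'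
    have hlogN : 0 ≤ Real.log N := Real.log_nonneg hN1
    have hlog : Real.log (16 * (Real.exp K / (16 * Real.sqrt d * μ)) * Real.sqrt (N * d) * μ) =
        K + Real.log N / 2 := by
      have : 16 * (Real.exp K / (16 * Real.sqrt d * μ)) * Real.sqrt (N * d) * μ =
          Real.exp K * Real.sqrt N := by
        rw [Real.sqrt_mul hN'.le]
        field_simp
      rw [this, Real.log_mul (Real.exp_pos _).ne' hsN.ne', Real.log_exp, Real.log_sqrt hN'.le]
    rw [hlog]
    have hR : (1 : ℝ) ≤ Fintype.card R := by exact_mod_cast Fintype.card_pos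
    -- From `|R| ≥ 1` and `d ≥ 2`. The factor `8` turns `(log N)/2` into the `4 log N` of the
    -- Rademacher bound, so that coefficient must not depend on the growth exponent.
    have hA : 8 ≤ 2 * (Fintype.card R : ℝ) * d ^ 2 := by nlinarith
    have hmain : Real.sqrt (K + 4 * Real.log N) ≤
        Real.sqrt (2 * (Fintype.card R : ℝ) * d ^ 2 * (K + Real.log N / 2)) := by
      refine Real.sqrt_le_sqrt ?_
      have := mul_le_mul_of_nonneg_right hA (show 0 ≤ K + Real.log N / 2 by positivity)
      linarith
    refine (HFrame.empiricalRademacher_le hN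
      (HFrame.lossClass_nonempty hB₁ hB₂ feat prune α) sample
      (B := 1 + Real.sqrt N * Real.sqrt (K + 4 * Real.log N)) ?_).trans ?_
    · intro f hf
      choose W hW hfW using hf
      simp only [hfW]
      exact hrad Λ feat prune α N sample hN hdeg W
    -- Of the `2/N`, one part comes from rounding to levels and one from the near-maximizers.
    · have hsplit : (N : ℝ)⁻¹ * (1 + Real.sqrt N * Real.sqrt (K + 4 * Real.log N) + 1) =
          2 / N + 1 / Real.sqrt N * Real.sqrt (K + 4 * Real.log N) := by
        have hss : Real.sqrt N * Real.sqrt N = N := Real.mul_self_sqrt hN'.le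
        have : (N : ℝ)⁻¹ * Real.sqrt N = 1 / Real.sqrt N := by
          rw [inv_mul_eq_div, div_eq_div_iff hN'.ne' hsN.ne', hss, one_mul]
        rw [← this]
        ring
      rw [hsplit]
      gcongr
      · norm_num
      · norm_num
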